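/- All graphs are finite and simple. A hole of a graph $G$ is an induced cycle of length at least $4$; $G$ is chordal if it has no hole. A nonempty set $X\subseteq V(G)$ is a hole cover of $G$ if every hole of $G$ contains a vertex of $X$. A vertex $u$ satisfies the NC property in $G$ if no hole containing $u$ shares two consecutive edges with a hole not containing $u$. A set $X\subseteq V(G)$ satisfies the NC property in $G$ if each of its vertices does and every hole of $G$ contains at most one vertex of $X$. To locally chordalize by $u$ means to join $u$ to all non-neighbours of $u$ that lie on a common hole with $u$. For a hole cover $X$ of $G$ satisfying the NC property, $\widehat{G}(X)$ denotes the graph obtained from $G$ by locally chordalizing successively by the vertices of $X$, in any order (the result does not depend on the order). A local chordalization partition of a hole cover $\mathcal C$ of $G$ is an ordered partition $(\mathcal C_1,\dots,\mathcal C_k)$ of $\mathcal C$ into nonempty sets such that, for each $i=1,\dots,k$, $\mathcal C_i$ is a hole cover of $G_i$ satisfying the NC property in $G_i$, and $G_i^*$ is chordal. Here $G_0^*=G-\mathcal C$ and, for $i\ge 1$, $G_i$ is the graph with $V(G_i)=V(G_{i-1}^*)\cup\mathcal C_i$ and $E(G_i)=E(G_{i-1}^*)\cup E\bigl(G-\bigcup_{j=i+1}^k\mathcal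 C_j\bigr)$, and $G_i^*=\widehat{G_i}(\mathcal C_i)$. The non-chordality index $i(G)$ is $0$ if $G$ is chordal, and otherwise the least $k$ for which some hole cover of $G$ has a local chordalization partition into $k$ sets. Let $\omega(G)$ be the clique number of $G$, and let $\chi_{DP}(G)$ be its DP-chromatic number: the least $k$ such that, for every assignment of lists $L(v)$ of at least $k$ colours to the vertices and every choice, for each edge $uv$, of a matching between $L(u)$ and $L(v)$, one can choose a colour from each list so that no two colours chosen at adjacent vertices are matched. **Theorem.** For every graph $G$, $$\chi_{DP}(G)\le \omega(G)+i(G).$$ Moreover, if $G$ is non-chordal and has no $K_n$ minor, then $$\chi_{DP}(G)\le n-2+i(G).$$ -/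

import Mathlib

namespace SimpleGraph

/-- `S` is the vertex set of a hole of `G`, that is, of an induced cycle of length at least four.
An induced cycle is determined by its vertex set, so holes are treated as vertex sets. -/
def IsHole {V : Type*} (G : SimpleGraph V) (S : Set V) : Prop :=
  ∃ n : ℕ, 4 ≤ n ∧ ∃ f : cycleGraph n ↪g G, Set.range f = S

/-- A graph is chordal if it has no hole. -/
def IsChordal {V : Type*} (G : SimpleGraph V) : Prop :=
  ∀ S : Set V, ¬ G.IsHole S

/-- A hole cover: a nonempty vertex set that meets every hole. -/
def IsHoleCover {V : Type*} (G : SimpleGraph V) (X : Set V) : Prop :=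
  X.Nonempty ∧ ∀ S : Set V, G.IsHole S → (S ∩ X).Nonempty

/-- The non-consecutive property of a vertex `u`: no hole through `u` and hole avoiding `u` share
two consecutive edges `xy`, `yz`. (The edges of a hole are exactly the edges of `G` between its
vertices, because a hole is an induced cycle.) -/
def VertexNC {V : Type*} (G : SimpleGraph V) (u : V) : Prop :=
  ∀ S T : Set V, G.IsHole S → G.IsHole T → u ∈ S → u ∉ T →
    ¬ ∃ x y z : V, x ≠ z ∧ G.Adj x y ∧ G.Adj y z ∧
      (x ∈ S ∧ y ∈ S ∧ z ∈ S) ∧ (x ∈ T ∧ y ∈ T ∧ z ∈ T)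

/-- The NC property of a vertex set `X` in `G`: each vertex of `X` satisfies the NC property, and
every hole contains at most one vertex of `X`. -/
def SetNC {V : Type*} (G : SimpleGraph V) (X : Set V) : Prop :=
  (∀ u ∈ X, G.VertexNC u) ∧ ∀ S : Set V, G.IsHole S → (S ∩ X).Subsingleton

/-- Locally chordalize, by `u`, all the holes through `u`: join `u` to every other vertex that
lies on a common hole with `u`. -/
def localChordalize {V : Type*} (G : SimpleGraph V) (u : V) : SimpleGraph V :=
  G ⊔ SimpleGraph.fromRel fun x y => x = u ∧ ∃ S : Set V, G.IsHole S ∧ u ∈ S ∧ y ∈ S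

/-- `G'` arises from `G` by local chordalizations performed successively by the vertices of `X`,
each used once, in some order. When `X` is a hole cover with the NC property, the
result does not depend on the order. -/
def IsLocalChordalization {V : Type*} (G : SimpleGraph V) (X : Set V) (G' : SimpleGraph V) : Prop :=
  ∃ l : List V, l.Nodup ∧ (∀ v, v ∈ l ↔ v ∈ X) ∧ G' = l.foldl localChordalize G

/-- The graph `G - X`. The deleted vertices are kept as isolated vertices; an isolated
vertex lies on no hole, so this affects neither the holes nor the notions built on them. -/
def deleteVerts {V : Type*} (G : SimpleGraph V) (X : Set V) : SimpleGraph V :=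
  (G.induce Xᶜ).spanningCoe

/-- `(P 0, …, P (k - 1))` is a local chordalization partition of the hole cover `X` of `G`.
Here `A i` is the graph obtained from the previous completion `B i` by restoring the vertices
of `P i` together with their edges of `G` (so that exactly the vertices in the later parts are still
missing), and `B (i + 1)` is the local chordalization of `A i` by `P i`. -/
def IsLocalChordalizationPartition {V : Type*} (G : SimpleGraph V) (X : Set V) {k : ℕ}
    (P : Fin k → Set V) : Prop :=
  G.IsHoleCover X ∧
  (∀ i, (P i).Nonempty) ∧ Pairwise (fun i j => Disjoint (P i) (P j)) ∧ (⋃ i, P i) = X ∧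
  ∃ (A : Fin k → SimpleGraph V) (B : Fin (k + 1) → SimpleGraph V),
    B 0 = G.deleteVerts X ∧
    ∀ i : Fin k,
      A i = B i.castSucc ⊔ G.deleteVerts (⋃ j ∈ Set.Ioi i, P j) ∧
      (A i).IsHoleCover (P i) ∧ (A i).SetNC (P i) ∧
      (A i).IsLocalChordalization (P i) (B i.succ) ∧
      (B i.succ).IsChordal

open Classical in
/-- The non-chordality index: `0` for a chordal graph, and otherwise the least number of
parts in a local chordalization partition of a hole cover. -/
noncomputable def nonChordalityIndex {V : Type*} (G : SimpleGraph V) : ℕ :=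
  if G.IsChordal then 0
  else sInf {k : ℕ | ∃ (X : Set V) (P : Fin k → Set V), G.IsLocalChordalizationPartition X P}

/-- A correspondence assignment: a finite list of colors for each vertex and, for each edge `uv`,
a matching `corr u v` between the lists of `u` and `v`. -/
structure CorrespondenceAssignment {V : Type*} (G : SimpleGraph V) where
  list : V → Finset ℕ
  corr : V → V → ℕ → ℕ → Prop
  adj_of_corr : ∀ {u v a b}, corr u v a b → G.Adj u v
  mem_of_corr : ∀ {u v a b}, corr u v a b → a ∈ list u ∧ b ∈ list v
  corr_symm : ∀ {u v a b}, corr u v a b → corr v u b a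
  corr_unique : ∀ {u v a b b'}, corr u v a b → corr u v a b' → b = b'

/-- A choice of a color from each list such that colors at adjacent vertices are not matched. -/
def CorrespondenceAssignment.IsColoring {V : Type*} {G : SimpleGraph V}
    (M : G.CorrespondenceAssignment) (φ : V → ℕ) : Prop :=
  (∀ v, φ v ∈ M.list v) ∧ ∀ u v, G.Adj u v → ¬ M.corr u v (φ u) (φ v)

/-- The DP-chromatic number (correspondence chromatic number) of a finite graph: the least `k` such
that every correspondence assignment with all lists of size at least `k` has a coloring. -/
noncomputable def dpChromaticNumber {V : Type*} (G : SimpleGraph V) : ℕ :=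
  sInf {k : ℕ | ∀ M : G.CorrespondenceAssignment, (∀ v, k ≤ (M.list v).card) →
    ∃ φ : V → ℕ, M.IsColoring φ}

/-- `H` is a minor of `G`: there are pairwise disjoint connected (in particular nonempty) branch
sets in `G`, indexed by the vertices of `H`, with an edge of `G` between the branch sets of any
two adjacent vertices of `H`. -/
def IsMinor {W V : Type*} (H : SimpleGraph W) (G : SimpleGraph V) : Prop :=
  ∃ B : W → Set V,
    (∀ w, (G.induce (B w)).Connected) ∧
    Pairwise (fun w w' => Disjoint (B w) (B w')) ∧
    ∀ w w', H.Adj w w' → ∃ x ∈ B w, ∃ y ∈ B w', G.Adj x y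

end SimpleGraph

/-!
The DP-chromatic number of `G` is at most the clique number of any chordal graph `H ≥ G`, because
`H` has a simplicial vertex (`IsChordal.exists_simplicial`) and greedy colouring works
(`dpChromaticNumber_le_of_chordal`). The graph `H` is the last completion of an optimal local
chordalization partition, and the point is to bound its cliques.

If `u` has the NC property, local chordalization by `u` leaves no hole through `u` and creates no
hole avoiding `u`. Indeed the set of neighbours and hole-mates of `u` has a convexity property
(`VertexNC.not_linked`): two non-adjacent members of it cannot be joined by a path outside it. So
chordalizing successively by the vertices of a set `X` with the NC property only adds edges `uw`
with `u ∈ X` and with `u`, `w` on a common hole of the original graph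
(`foldl_localChordalize_adj`). Two disjoint edges of this kind inside a clique of the completion
would lead to a hole with two vertices in `X`; hence the added edges inside a clique form a star,
and deleting its centre leaves a clique of the graph before completion
(`SetNC.exists_pairwise_diff_singleton`). Applied to each of the `k` parts, this shows that
deleting `k` vertices from a clique of `H` leaves a clique of `G`.

For the bound on graphs without a `K_n` minor, only `k - 1` vertices are deleted. What is left is a
clique of the first completion, thus a clique of `G` and one more vertex `c` that is joined to
each vertex of it by an edge or lies with it on a hole of `G`. The component of `c` off the clique
then serves as a branch set, and the clique together with `c` gives a complete minor
(`isMinor_completeGraph`).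

Finally a partition exists at all: restore the vertices one by one, in any order
(`exists_isLocalChordalizationPartition`).
-/

namespace SimpleGraph
open Relation

variable {V : Type*} {G : SimpleGraph V}

/-! ### Walks inside a set, induced paths and holes -/

theorem deleteVerts_adj {X : Set V} {x y : V} :
    (G.deleteVerts X).Adj x y ↔ G.Adj x y ∧ x ∉ X ∧ y ∉ X := by
  simp only [deleteVerts, map_adj, comap_adj, Function.Embedding.subtype_apply]
  constructor
  · rintro ⟨⟨a, ha⟩, ⟨b, hb⟩, h, rfl, rfl⟩
    exact ⟨h, ha, hb⟩
  · rintro ⟨h, hx, hy⟩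
    exact ⟨⟨x, hx⟩, ⟨y, hy⟩, h, rfl, rfl⟩

theorem localChordalize_adj {u x y : V} :
    (G.localChordalize u).Adj x y ↔ G.Adj x y ∨ (x ≠ y ∧ (x = u ∨ y = u) ∧
      ∃ S, G.IsHole S ∧ x ∈ S ∧ y ∈ S) := by
  simp only [localChordalize, sup_adj, fromRel_adj]
  constructor
  · rintro (h | ⟨hne, ⟨rfl, S, hS, h1, h2⟩ | ⟨rfl, S, hS, h1, h2⟩⟩)
    · exact Or.inl h
    · exact Or.inr ⟨hne, Or.inl rfl, S, hS, h1, h2⟩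
    · exact Or.inr ⟨hne, Or.inr rfl, S, hS, h2, h1⟩
  · rintro (h | ⟨hne, rfl | rfl, S, hS, h1, h2⟩)
    · exact Or.inl h
    · exact Or.inr ⟨hne, Or.inl ⟨rfl, S, hS, h1, h2⟩⟩
    · exact Or.inr ⟨hne, Or.inr ⟨rfl, S, hS, h2, h1⟩⟩

/-- `G.Linked C s t`: the vertices `s` and `t` are joined by a walk of `G` inside `C`. For `s = t`
this holds even if `s ∉ C`. -/
def Linked (G : SimpleGraph V) (C : Set V) : V → V → Prop :=
  ReflTransGen fun x y => G.Adj x y ∧ x ∈ C ∧ y ∈ C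

theorem Linked.refl {C : Set V} (s : V) : G.Linked C s s := ReflTransGen.refl

theorem Linked.trans {C : Set V} {s t r : V} (h : G.Linked C s t) (h' : G.Linked C t r) :
    G.Linked C s r := ReflTransGen.trans h h'

theorem Linked.symm {C : Set V} {s t : V} (h : G.Linked C s t) : G.Linked C t s := by
  induction h with
  | refl => exact ReflTransGen.refl
  | tail _ h ih => exact ReflTransGen.head ⟨h.1.symm, h.2.2, h.2.1⟩ ih

theorem Linked.mono {C D : Set V} (hCD : C ⊆ D) {s t : V} (h : G.Linked C s t) :
    G.Linked D s t :=
  ReflTransGen.mono (fun _ _ h => ⟨h.1, hCD h.2.1, hCD h.2.2⟩) _ _ h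

theorem Linked.of_adj {C : Set V} {s t : V} (h : G.Adj s t) (hs : s ∈ C) (ht : t ∈ C) :
    G.Linked C s t := ReflTransGen.single ⟨h, hs, ht⟩

/-- `p` and `q` are equal or adjacent. -/
def Touch (G : SimpleGraph V) (p q : V) : Prop := p = q ∨ G.Adj p q

theorem Touch.symm {p q : V} (h : G.Touch p q) : G.Touch q p :=
  h.elim (fun h => Or.inl h.symm) fun h => Or.inr h.symm

theorem Touch.linked {C : Set V} {s t : V} (h : G.Touch s t) (hs : s ∈ C) (ht : t ∈ C) :
    G.Linked C s t := by
  rcases h with rfl | h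
  · exact .refl _
  · exact .of_adj h hs ht

/-- A walk inside `C₁ ∪ C₂` that starts in `C₁` stays there if `C₁` and `C₂` do not touch. -/
theorem Linked.mem_of_not_touch {C C₁ C₂ : Set V} (hC : C ⊆ C₁ ∪ C₂)
    (hno : ∀ p ∈ C₁, ∀ q ∈ C₂, ¬ G.Touch p q) {s t : V} (hs : s ∈ C₁) (h : G.Linked C s t) :
    t ∈ C₁ := by
  induction h with
  | refl => exact hs
  | tail _ h ih => exact (hC h.2.2).resolve_right fun h2 => hno _ ih _ h2 (Or.inr h.1)

/-- The vertices `f 0, …, f m` are distinct and induce a path of `G`, in this order. -/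
structure IsInducedPath (G : SimpleGraph V) (f : ℕ → V) (m : ℕ) : Prop where
  inj : ∀ i j, i ≤ m → j ≤ m → f i = f j → i = j
  adj : ∀ i j, i ≤ m → j ≤ m → (G.Adj (f i) (f j) ↔ i + 1 = j ∨ j + 1 = i)

theorem IsInducedPath.linked_le {f : ℕ → V} {m : ℕ} (hf : G.IsInducedPath f m) {C : Set V}
    {i j : ℕ} (hij : i ≤ j) (hj : j ≤ m) (hC : ∀ l, i ≤ l → l ≤ j → f l ∈ C) :
    G.Linked C (f i) (f j) := by
  induction j, hij using Nat.le_induction with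
  | base => exact .refl _
  | succ j hij ih =>
    refine (ih (by omega) fun l h1 h2 => hC l h1 (by omega)).trans
      (.of_adj ((hf.adj _ _ (by omega) hj).2 (Or.inl rfl)) (hC _ hij (by omega))
        (hC _ (by omega) le_rfl))

/-- Two vertices linked inside `C` are joined by an induced path inside `C`. -/
theorem Linked.exists_isInducedPath {C : Set V} {s t : V} (h : G.Linked C s t) (ht : t ∈ C) :
    ∃ (f : ℕ → V) (m : ℕ), G.IsInducedPath f m ∧ f 0 = s ∧ f m = t ∧ ∀ i ≤ m, f i ∈ C := by
  classical
  induction h using ReflTransGen.head_induction_on with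
  | refl =>
    refine ⟨fun _ => t, 0, ⟨fun i j _ _ _ => by omega, ?_⟩, rfl, rfl, fun _ _ => ht⟩
    intro i j hi hj
    simp only [SimpleGraph.irrefl, false_iff]
    omega
  | @head s y hsy _ ih =>
    obtain ⟨f, m, hf, h0, hm, hC⟩ := ih
    by_cases hs : ∃ i ≤ m, f i = s
    · obtain ⟨i, hi, his⟩ := hs
      refine ⟨fun j => f (i + j), m - i, ⟨fun j l hj hl h => ?_, fun j l hj hl => ?_⟩, his, ?_,
        fun j hj => hC _ (by omega)⟩
      · have := hf.inj _ _ (by omega) (by omega) h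
        omega
      · rw [hf.adj _ _ (by omega) (by omega)]
        omega
      · rw [← hm]
        exact congrArg f (by omega)
    · push Not at hs
      -- shortcut to the last vertex of the path that is adjacent to `s`
      have hex : ∃ i, i ≤ m ∧ G.Adj s (f i) := ⟨0, by omega, h0 ▸ hsy.1⟩
      obtain ⟨i, ⟨him, hi⟩, hmax⟩ : ∃ i, (i ≤ m ∧ G.Adj s (f i)) ∧
          ∀ j, j ≤ m → G.Adj s (f j) → j ≤ i := by
        obtain ⟨i0, h1, h2⟩ := hex
        refine ⟨Nat.findGreatest (fun i => G.Adj s (f i)) m,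
          ⟨Nat.findGreatest_le _, Nat.findGreatest_spec (P := fun i => G.Adj s (f i)) h1 h2⟩,
          fun j hj h => Nat.le_findGreatest hj h⟩
      have hs0 : ∀ j, j ≤ m - i → (G.Adj s (f (i + j)) ↔ j = 0) := by
        intro j hj
        constructor
        · intro h
          have := hmax _ (by omega) h
          omega
        · rintro rfl
          exact hi
      refine ⟨fun j => if j = 0 then s else f (i + (j - 1)), m - i + 1,
        ⟨fun j l hj hl h => ?_, fun j l hj hl => ?_⟩, rfl, ?_, fun j hj => ?_⟩
      · rcases Nat.eq_zero_or_pos j with rfl | hj0 <;> rcases Nat.eq_zero_or_pos l with rfl | hl0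
        · rfl
        · rw [if_pos rfl, if_neg hl0.ne'] at h
          exact absurd h.symm (hs _ (by omega))
        · rw [if_pos rfl, if_neg hj0.ne'] at h
          exact absurd h (hs _ (by omega))
        · rw [if_neg hj0.ne', if_neg hl0.ne'] at h
          have := hf.inj _ _ (by omega) (by omega) h
          omega
      · rcases Nat.eq_zero_or_pos j with rfl | hj0 <;> rcases Nat.eq_zero_or_pos l with rfl | hl0
        · simp
        · rw [if_pos rfl, if_neg hl0.ne', hs0 _ (by omega)]
          omega
        · rw [if_pos rfl, if_neg hj0.ne', G.adj_comm, hs0 _ (by omega)]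
          omega
        · rw [if_neg hj0.ne', if_neg hl0.ne', hf.adj _ _ (by omega) (by omega)]
          omega
      · change (if m - i + 1 = 0 then s else f (i + (m - i + 1 - 1))) = t
        rw [if_neg (by omega), ← hm]
        congr 1
        omega
      · dsimp only
        split_ifs
        · exact hsy.2.1
        · exact hC _ (by omega)

/-- Adjacency in a cycle graph in terms of the values of the vertices. -/
theorem cycleGraph_adj_val {n : ℕ} (hn : 2 ≤ n) (i j : Fin n) :
    (cycleGraph n).Adj i j ↔ i.val + 1 = j.val ∨ j.val + 1 = i.val ∨
      (i.val = 0 ∧ j.val + 1 = n) ∨ (j.val = 0 ∧ i.val + 1 = n) := by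
  rw [cycleGraph_adj']
  have key : ∀ a b : Fin n, (a - b).val = 1 ↔ b.val + 1 = a.val ∨ (a.val = 0 ∧ b.val + 1 = n) := by
    intro a b
    have ha := a.isLt
    have hb := b.isLt
    rcases le_or_gt b a with h | h
    · rw [Fin.coe_sub_iff_le.2 h]
      have : b.val ≤ a.val := h
      omega
    · rw [Fin.coe_sub_iff_lt.2 h]
      have : a.val < b.val := h
      omega
  rw [key, key]
  omega

/-- A vertex joined to exactly the two ends of an induced path closes it to a hole. -/
theorem IsInducedPath.isHole {f : ℕ → V} {m : ℕ} (hf : G.IsInducedPath f m) (hm : 2 ≤ m) {v : V}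
    (hv : ∀ i ≤ m, f i ≠ v) (hadj : ∀ i ≤ m, (G.Adj v (f i) ↔ i = 0 ∨ i = m)) :
    G.IsHole (insert v (f '' Set.Iic m)) := by
  refine ⟨m + 2, by omega, ⟨⟨fun i => if i.val = 0 then v else f (i.val - 1), ?_⟩, ?_⟩, ?_⟩
  · intro i j h
    have hi := i.isLt
    have hj := j.isLt
    dsimp only at h
    ext
    split_ifs at h with h1 h2 h2
    · omega
    · exact absurd h.symm (hv _ (by omega))
    · exact absurd h (hv _ (by omega))
    · have := hf.inj _ _ (by omega) (by omega) h
      omega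
  · intro i j
    have hi := i.isLt
    have hj := j.isLt
    rw [cycleGraph_adj_val (by omega)]
    change G.Adj (if i.val = 0 then v else f (i.val - 1))
      (if j.val = 0 then v else f (j.val - 1)) ↔ _
    split_ifs with h1 h2 h2
    · simp only [SimpleGraph.irrefl, false_iff]
      omega
    · rw [hadj _ (by omega)]
      omega
    · rw [G.adj_comm, hadj _ (by omega)]
      omega
    · rw [hf.adj _ _ (by omega) (by omega)]
      omega
  · ext x
    simp only [Set.mem_range, Set.mem_insert_iff, Set.mem_image, Set.mem_Iic]
    constructor
    · rintro ⟨i, rfl⟩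
      have hi := i.isLt
      change (if i.val = 0 then v else f (i.val - 1)) = v ∨
        ∃ l ≤ m, f l = if i.val = 0 then v else f (i.val - 1)
      split_ifs with h
      · exact Or.inl rfl
      · exact Or.inr ⟨_, by omega, rfl⟩
    · rintro (rfl | ⟨j, hj, rfl⟩)
      · refine ⟨⟨0, by omega⟩, ?_⟩
        change (if 0 = 0 then x else f (0 - 1)) = x
        simp
      · refine ⟨⟨j + 1, by omega⟩, ?_⟩
        change (if j + 1 = 0 then v else f (j + 1 - 1)) = f j
        simp

/-- A hole through `v` consists of `v` and an induced path whose ends are the only neighbours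
of `v` on it. -/
theorem IsHole.exists_isInducedPath {S : Set V} (hS : G.IsHole S) {v : V} (hv : v ∈ S) :
    ∃ (f : ℕ → V) (m : ℕ), G.IsInducedPath f m ∧ 2 ≤ m ∧ (∀ i ≤ m, f i ≠ v) ∧
      (∀ i ≤ m, (G.Adj v (f i) ↔ i = 0 ∨ i = m)) ∧ S = insert v (f '' Set.Iic m) := by
  obtain ⟨n, hn, e, rfl⟩ := hS
  obtain ⟨k, rfl⟩ := hv
  have hk := k.isLt
  -- `g j` is the vertex `j + 1` steps after `k` on the cycle
  let g : ℕ → Fin n := fun j =>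
    if h : k.val + j + 1 < n then ⟨k.val + j + 1, h⟩ else ⟨(k.val + j + 1 - n) % n,
      Nat.mod_lt _ (by omega)⟩
  have hg : ∀ j ≤ n - 2, (g j).val = k.val + j + 1 ∨
      ((g j).val + n = k.val + j + 1) := by
    intro j hj
    by_cases h : k.val + j + 1 < n
    · left
      simp only [g, dif_pos h]
    · right
      simp only [g, dif_neg h]
      rw [Nat.mod_eq_of_lt (by omega)]
      omega
  refine ⟨fun j => e (g j), n - 2, ⟨fun i j hi hj h => ?_, fun i j hi hj => ?_⟩, by omega,
    fun i hi h => ?_, fun i hi => ?_, ?_⟩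
  · have h := congrArg Fin.val (e.injective h)
    have := hg i hi
    have := hg j hj
    have := (g i).isLt
    have := (g j).isLt
    omega
  · rw [e.map_adj_iff, cycleGraph_adj_val (by omega)]
    have := hg i hi
    have := hg j hj
    have := (g i).isLt
    have := (g j).isLt
    omega
  · have h := congrArg Fin.val (e.injective h)
    have := hg i hi
    have := (g i).isLt
    omega
  · rw [e.map_adj_iff, cycleGraph_adj_val (by omega)]
    have := hg i hi
    have := (g i).isLt
    omega
  · ext x
    simp only [Set.mem_range, Set.mem_insert_iff, Set.mem_image, Set.mem_Iic]
    constructor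
    · rintro ⟨i, rfl⟩
      by_cases hik : i = k
      · exact Or.inl (by rw [hik])
      · have hik' : i.val ≠ k.val := fun h => hik (Fin.ext h)
        have hi := i.isLt
        right
        rcases lt_or_gt_of_ne hik' with h | h
        · refine ⟨i.val + n - k.val - 1, by omega, congrArg e (Fin.ext ?_)⟩
          have := hg (i.val + n - k.val - 1) (by omega)
          have := (g (i.val + n - k.val - 1)).isLt
          omega
        · refine ⟨i.val - k.val - 1, by omega, congrArg e (Fin.ext ?_)⟩
          have := hg (i.val - k.val - 1) (by omega)
          have := (g (i.val - k.val - 1)).isLt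
          omega
    · rintro (rfl | ⟨j, -, rfl⟩)
      · exact ⟨_, rfl⟩
      · exact ⟨_, rfl⟩

/-- If exactly two vertices `s`, `t` of `C` are neighbours of `v`, they are not adjacent, and they
are linked inside `C`, then a shortest path from `s` to `t` in `C` closes up with `v` to a hole. -/
theorem Linked.exists_isHole {C : Set V} {v s t : V} (h : G.Linked C s t) (hv : v ∉ C)
    (ht : t ∈ C) (hvs : G.Adj v s) (hvt : G.Adj v t) (hst : ¬ G.Touch s t)
    (honly : ∀ c ∈ C, G.Adj v c → c = s ∨ c = t) :
    ∃ S, G.IsHole S ∧ v ∈ S ∧ s ∈ S ∧ t ∈ S ∧ S ⊆ insert v C ∧ G.Linked (S \ {v}) s t := by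
  obtain ⟨f, m, hf, rfl, rfl, hC⟩ := h.exists_isInducedPath ht
  have hm : 2 ≤ m := by
    by_contra hm
    obtain rfl | rfl : m = 0 ∨ m = 1 := by omega
    · exact hst (Or.inl rfl)
    · exact hst (Or.inr ((hf.adj 0 1 (by omega) le_rfl).2 (Or.inl rfl)))
  have hne : ∀ i ≤ m, f i ≠ v := fun i hi h => hv (h ▸ hC i hi)
  have hmem : ∀ i ≤ m, f i ∈ insert v (f '' Set.Iic m) := fun i hi =>
    Or.inr (Set.mem_image_of_mem f hi)
  refine ⟨_, hf.isHole hm hne fun i hi => ⟨fun h => ?_, ?_⟩, Set.mem_insert _ _,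
    hmem _ (Nat.zero_le _), hmem _ le_rfl, ?_, ?_⟩
  · exact (honly _ (hC i hi) h).imp (hf.inj _ _ hi (Nat.zero_le _)) (hf.inj _ _ hi le_rfl)
  · rintro (rfl | rfl)
    exacts [hvs, hvt]
  · rintro x (rfl | ⟨i, hi, rfl⟩)
    · exact Set.mem_insert _ _
    · exact Or.inr (hC i hi)
  · exact hf.linked_le (Nat.zero_le _) le_rfl fun l _ hl => ⟨hmem l hl, hne l hl⟩

/-- If `s` and `t` lie in parts `C₁`, `C₂` that do not touch, then the hole of
`Linked.exists_isHole` passes through the remaining part `K`. -/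
theorem Linked.exists_isHole_inter {C₁ K C₂ : Set V} {v s t : V}
    (h : G.Linked (C₁ ∪ K ∪ C₂) s t) (hv : v ∉ C₁ ∪ K ∪ C₂)
    (hs : s ∈ C₁) (ht : t ∈ C₂) (hvs : G.Adj v s) (hvt : G.Adj v t)
    (hno : ∀ p ∈ C₁, ∀ q ∈ C₂, ¬ G.Touch p q)
    (honly : ∀ c ∈ C₁ ∪ K ∪ C₂, G.Adj v c → c = s ∨ c = t) :
    ∃ S, G.IsHole S ∧ v ∈ S ∧ s ∈ S ∧ t ∈ S ∧ (S ∩ K).Nonempty := by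
  obtain ⟨S, hS, hvS, hsS, htS, hsub, hl⟩ :=
    h.exists_isHole hv (Or.inr ht) hvs hvt (hno s hs t ht) honly
  refine ⟨S, hS, hvS, hsS, htS, ?_⟩
  by_contra hK
  rw [Set.not_nonempty_iff_eq_empty] at hK
  have : t ∈ C₁ := by
    refine hl.mem_of_not_touch (fun x hx => ?_) hno hs
    rcases hsub hx.1 with h | (h | h) | h
    · exact absurd h hx.2
    · exact Or.inl h
    · exact absurd (Set.mem_inter hx.1 h) (Set.eq_empty_iff_forall_notMem.1 hK x)
    · exact Or.inr h
  exact hno t this t ht (Or.inl rfl)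

theorem IsHole.congr {H : SimpleGraph V} {S : Set V} (hS : G.IsHole S)
    (h : ∀ x ∈ S, ∀ y ∈ S, (G.Adj x y ↔ H.Adj x y)) : H.IsHole S := by
  obtain ⟨n, hn, e, rfl⟩ := hS
  refine ⟨n, hn, ⟨e.toEmbedding, fun {a b} => ?_⟩, rfl⟩
  exact (h _ ⟨a, rfl⟩ _ ⟨b, rfl⟩).symm.trans e.map_adj_iff

theorem IsHole.nonempty {S : Set V} (hS : G.IsHole S) : S.Nonempty := by
  obtain ⟨n, hn, e, rfl⟩ := hS
  exact ⟨_, ⟨0, by omega⟩, rfl⟩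

/-- Every vertex of a hole has a neighbour. -/
theorem IsHole.exists_adj {S : Set V} (hS : G.IsHole S) {v : V} (hv : v ∈ S) :
    ∃ x, G.Adj v x := by
  obtain ⟨f, m, -, -, -, hadj, -⟩ := hS.exists_isInducedPath hv
  exact ⟨f 0, (hadj 0 (Nat.zero_le _)).2 (Or.inl rfl)⟩

/-! ### Local chordalization by a vertex with the NC property -/

theorem IsInducedPath.linked_Icc {f : ℕ → V} {m : ℕ} (hf : G.IsInducedPath f m) {i j : ℕ}
    (hj : j ≤ m) : ∀ p ∈ f '' Set.Icc i j, ∀ q ∈ f '' Set.Icc i j,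
      G.Linked (f '' Set.Icc i j) p q := by
  have key : ∀ a b, i ≤ a → a ≤ b → b ≤ j → G.Linked (f '' Set.Icc i j) (f a) (f b) :=
    fun a b h1 h2 h3 => hf.linked_le h2 (by omega) fun l h4 h5 =>
      Set.mem_image_of_mem f ⟨by omega, by omega⟩
  rintro _ ⟨a, ha, rfl⟩ _ ⟨b, hb, rfl⟩
  rcases le_total a b with h | h
  · exact key a b ha.1 h hb.2
  · exact (key b a hb.1 h ha.2).symm

/-- A connected set `D` avoiding `u` and the closed neighbourhood of an inner vertex `f i` of the
path left by a hole through `u` cannot touch this path on both sides of `f i`: otherwise, going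
around through `D`, there would be a hole avoiding `u` that contains `f (i - 1)`, `f i` and
`f (i + 1)`. -/
theorem VertexNC.not_touch_both_sides {u : V} (hu : G.VertexNC u) {f : ℕ → V} {m : ℕ}
    (hf : G.IsInducedPath f m) (hfu : ∀ i ≤ m, f i ≠ u)
    (hS : G.IsHole (insert u (f '' Set.Iic m))) {i : ℕ} {D : Set V} (huD : u ∉ D)
    (hi : i ≤ m) (hiD : ∀ d ∈ D, ¬ G.Touch (f i) d)
    (hD : ∀ p ∈ D, ∀ q ∈ D, G.Linked D p q)
    {j k : ℕ} (hj : j ≤ i) (hk : i ≤ k) (hkm : k ≤ m) {p q : V} (hp : p ∈ D) (hq : q ∈ D)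
    (hjp : G.Touch (f j) p) (hkq : G.Touch (f k) q) : False := by
  have hji : j < i := lt_of_le_of_ne hj fun h => hiD p hp (h ▸ hjp)
  have hik : i < k := lt_of_le_of_ne hk fun h => hiD q hq (h ▸ hkq)
  set C : Set V := (f '' {l | l ≤ m ∧ l ≠ i}) ∪ D with hC
  have hmem : ∀ l, l ≤ m → l ≠ i → f l ∈ C := fun l h1 h2 =>
    Or.inl (Set.mem_image_of_mem f ⟨h1, h2⟩)
  have hvC : f i ∉ C := by
    rintro (⟨l, ⟨h1, h2⟩, h3⟩ | h)
    · exact h2 (hf.inj _ _ h1 hi h3)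
    · exact hiD _ h (Or.inl rfl)
  have hl : G.Linked C (f (i - 1)) (f (i + 1)) := by
    have h1 : G.Linked C (f j) (f (i - 1)) :=
      hf.linked_le (by omega) (by omega) fun l h3 h4 => hmem l (by omega) (by omega)
    have h2 : G.Linked C (f (i + 1)) (f k) :=
      hf.linked_le (by omega) (by omega) fun l h3 h4 => hmem l (by omega) (by omega)
    exact (((h1.symm.trans (hjp.linked (hmem _ (by omega) (by omega)) (Or.inr hp))).trans
      ((hD p hp q hq).mono Set.subset_union_right)).trans
      (hkq.symm.linked (Or.inr hq) (hmem _ (by omega) (by omega)))).trans h2.symm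
  have ha1 : G.Adj (f i) (f (i - 1)) := (hf.adj _ _ (by omega) (by omega)).2 (by omega)
  have ha2 : G.Adj (f i) (f (i + 1)) := (hf.adj _ _ (by omega) (by omega)).2 (by omega)
  have hne : f (i - 1) ≠ f (i + 1) := fun h => by
    have := hf.inj _ _ (by omega) (by omega) h
    omega
  obtain ⟨T, hT, h1, h2, h3, h4, -⟩ := hl.exists_isHole hvC (hmem _ (by omega) (by omega)) ha1 ha2
    (by
      rintro (h | h)
      · exact hne h
      · rw [hf.adj _ _ (by omega) (by omega)] at h
        omega)
    (by
      rintro c (⟨l, ⟨h1, h2⟩, rfl⟩ | h) hc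
      · rw [hf.adj _ _ (by omega) h1] at hc
        rcases hc with h | h
        · exact Or.inr (by rw [h])
        · exact Or.inl (congrArg f (by omega))
      · exact absurd (Or.inr hc) (hiD c h))
  have hS' : ∀ l ≤ m, f l ∈ insert u (f '' Set.Iic m) := fun l h =>
    Or.inr (Set.mem_image_of_mem f h)
  refine hu _ T hS hT (Set.mem_insert _ _) (fun h => ?_) ⟨f (i - 1), f i, f (i + 1), hne,
    ha1.symm, ha2, ⟨hS' _ (by omega), hS' _ hi, hS' _ (by omega)⟩, h2, h1, h3⟩
  rcases h4 h with h | ⟨l, h, hl⟩ | h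
  · exact hfu i hi h.symm
  · exact hfu l h.1 hl
  · exact huD h

/-- `α` is a connected set that contains `a`, avoids `u`, and contains exactly one neighbour `x`
of `u`. -/
structure IsArm (G : SimpleGraph V) (u a : V) (α : Set V) (x : V) : Prop where
  start_mem : a ∈ α
  end_mem : x ∈ α
  notMem : u ∉ α
  adj : G.Adj u x
  eq_of_adj : ∀ c ∈ α, G.Adj u c → c = x
  linked : ∀ p ∈ α, ∀ q ∈ α, G.Linked α p q

theorem isArm_singleton {u a : V} (h : G.Adj u a) : G.IsArm u a {a} a where
  start_mem := rfl
  end_mem := rfl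
  notMem := h.ne
  adj := h
  eq_of_adj := fun _ hc _ => hc
  linked := by
    rintro p rfl q rfl
    exact .refl _

theorem IsInducedPath.isArm_left {u : V} {f : ℕ → V} {m : ℕ} (hf : G.IsInducedPath f m)
    (hfu : ∀ i ≤ m, f i ≠ u) (hadj : ∀ i ≤ m, (G.Adj u (f i) ↔ i = 0 ∨ i = m)) {i : ℕ}
    (hi : i < m) : G.IsArm u (f i) (f '' Set.Icc 0 i) (f 0) where
  start_mem := ⟨i, ⟨by omega, le_rfl⟩, rfl⟩
  end_mem := ⟨0, ⟨le_rfl, by omega⟩, rfl⟩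
  notMem := by
    rintro ⟨l, hl, h⟩
    exact hfu l (hl.2.trans hi.le) h
  adj := (hadj 0 (by omega)).2 (Or.inl rfl)
  eq_of_adj := by
    rintro _ ⟨l, hl, rfl⟩ h
    have := hl.2
    rw [hadj l (by omega)] at h
    exact congrArg f (by omega)
  linked := hf.linked_Icc hi.le

theorem IsInducedPath.isArm_right {u : V} {f : ℕ → V} {m : ℕ} (hf : G.IsInducedPath f m)
    (hfu : ∀ i ≤ m, f i ≠ u) (hadj : ∀ i ≤ m, (G.Adj u (f i) ↔ i = 0 ∨ i = m)) {i : ℕ}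
    (hi : 0 < i) (him : i ≤ m) : G.IsArm u (f i) (f '' Set.Icc i m) (f m) where
  start_mem := ⟨i, ⟨le_rfl, him⟩, rfl⟩
  end_mem := ⟨m, ⟨him, le_rfl⟩, rfl⟩
  notMem := by
    rintro ⟨l, hl, h⟩
    exact hfu l hl.2 h
  adj := (hadj m le_rfl).2 (Or.inr rfl)
  eq_of_adj := by
    rintro _ ⟨l, hl, rfl⟩ h
    have := hl.1
    rw [hadj l hl.2] at h
    exact congrArg f (by omega)
  linked := hf.linked_Icc le_rfl

/-- If no vertex of `K` is a neighbour of `u` or on a common hole with `u`, and `K` links `a`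
to `b`, then every arm of `a` touches every arm of `b`: two arms that do not touch would give,
together with `K`, a hole through `u` and a vertex of `K`. -/
theorem IsArm.touch {u a b x z : V} {α β K : Set V} (hα : G.IsArm u a α x) (hβ : G.IsArm u b β z)
    (huK : u ∉ K) (hKadj : ∀ k ∈ K, ¬ G.Adj u k) (hKS : ∀ S, G.IsHole S → u ∈ S → ∀ k ∈ K, k ∉ S)
    (hK : G.Linked (insert a (insert b K)) a b) : ∃ p ∈ α, ∃ q ∈ β, G.Touch p q := by
  by_contra! hno
  have hl : G.Linked (α ∪ K ∪ β) x z := by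
    refine (((hα.linked x hα.end_mem a hα.start_mem).mono fun _ h => Or.inl (Or.inl h)).trans
      (hK.mono ?_)).trans ((hβ.linked b hβ.start_mem z hβ.end_mem).mono fun _ h => Or.inr h)
    rintro y (rfl | rfl | h)
    · exact Or.inl (Or.inl hα.start_mem)
    · exact Or.inr hβ.start_mem
    · exact Or.inl (Or.inr h)
  obtain ⟨S, hS, huS, -, -, k, hkS, hkK⟩ := hl.exists_isHole_inter (v := u)
    (by
      rintro ((h | h) | h)
      exacts [hα.notMem h, huK h, hβ.notMem h])
    hα.end_mem hβ.end_mem hα.adj hβ.adj hno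
    (by
      rintro c ((h | h) | h) hc
      · exact Or.inl (hα.eq_of_adj c h hc)
      · exact absurd hc (hKadj c h)
      · exact Or.inr (hβ.eq_of_adj c h hc))
  exact hKS S hS huS k hkK hkS

/-- The convexity statement behind local chordalization.
Let `u` have the NC property and let `a ≠ b` be non-adjacent vertices, each a neighbour of `u`
or on a common hole with `u`. Then `a` and `b` are not linked through vertices that are neither. -/
theorem VertexNC.not_linked {u a b : V} {K : Set V} (hu : G.VertexNC u) (hab : ¬ G.Touch a b)
    (hau : a ≠ u) (hbu : b ≠ u) (huK : u ∉ K) (hKadj : ∀ k ∈ K, ¬ G.Adj u k)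
    (hKS : ∀ S, G.IsHole S → u ∈ S → ∀ k ∈ K, k ∉ S)
    (hK : G.Linked (insert a (insert b K)) a b)
    (ha : G.Adj u a ∨ ∃ S, G.IsHole S ∧ u ∈ S ∧ a ∈ S)
    (hb : G.Adj u b ∨ ∃ S, G.IsHole S ∧ u ∈ S ∧ b ∈ S) : False := by
  -- an arm of one of the two vertices touches the other vertex if the latter is not adjacent to `u`
  have key : ∀ {a b : V}, a ≠ u → ¬ G.Adj u a →
      (∃ S, G.IsHole S ∧ u ∈ S ∧ a ∈ S) → G.Linked (insert a (insert b K)) a b →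
      ∀ {β z}, G.IsArm u b β z → ∃ q ∈ β, G.Touch a q := by
    rintro a b hau hua ⟨S, hS, huS, haS⟩ hK β z hβ
    by_contra! hno
    obtain ⟨f, m, hf, hm, hfu, hadj, rfl⟩ := hS.exists_isInducedPath huS
    obtain rfl | ⟨i, hi, rfl⟩ := haS
    · exact hau rfl
    rw [hadj i hi] at hua
    have hi : i ≤ m := hi
    obtain ⟨_, ⟨j, hj, rfl⟩, q1, hq1, ht1⟩ := (hf.isArm_left hfu hadj
      (show i < m by omega)).touch hβ huK hKadj hKS hK
    obtain ⟨_, ⟨k, hk, rfl⟩, q2, hq2, ht2⟩ := (hf.isArm_right hfu hadj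
      (show 0 < i by omega) hi).touch hβ huK hKadj hKS hK
    exact hu.not_touch_both_sides hf hfu hS hβ.notMem hi hno hβ.linked hj.2 hk.1 hk.2 hq1 hq2
      ht1 ht2
  have hK' : G.Linked (insert b (insert a K)) b a := by
    rw [Set.insert_comm]
    exact hK.symm
  by_cases hua : G.Adj u a
  · by_cases hub : G.Adj u b
    · obtain ⟨p, rfl, q, rfl, h⟩ :=
        (isArm_singleton hua).touch (isArm_singleton hub) huK hKadj hKS hK
      exact hab h
    · obtain ⟨q, rfl, h⟩ := key hbu hub (hb.resolve_left hub) hK' (isArm_singleton hua)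
      exact hab h.symm
  · by_cases hub : G.Adj u b
    · obtain ⟨q, rfl, h⟩ := key hau hua (ha.resolve_left hua) hK (isArm_singleton hub)
      exact hab h
    · obtain ⟨S, hS, huS, hbS⟩ := hb.resolve_left hub
      obtain ⟨g, m, hg, hm, hgu, hadj, rfl⟩ := hS.exists_isInducedPath huS
      obtain rfl | ⟨j, hj, rfl⟩ := hbS
      · exact hbu rfl
      have hj : j ≤ m := hj
      have hub' := hub
      rw [hadj j hj] at hub'
      obtain ⟨_, ⟨k, hk, rfl⟩, h1⟩ := key hau hua (ha.resolve_left hua) hK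
        (hg.isArm_left hgu hadj (show j < m by omega))
      obtain ⟨_, ⟨l, hl, rfl⟩, h2⟩ := key hau hua (ha.resolve_left hua) hK
        (hg.isArm_right hgu hadj (show 0 < j by omega) hj)
      refine hu.not_touch_both_sides hg hgu hS (D := {a}) (Ne.symm hau) hj ?_ ?_ hk.2 hl.1 hl.2
        rfl rfl h1.symm h2.symm
      · rintro d rfl h
        exact hab h.symm
      · rintro p rfl q rfl
        exact .refl _

/-- After local chordalization by a vertex `u` with the NC property, no hole passes through `u`. -/
theorem VertexNC.notMem_of_isHole_localChordalize {u : V} (hu : G.VertexNC u) {S : Set V}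
    (hS : (G.localChordalize u).IsHole S) : u ∉ S := by
  intro huS
  obtain ⟨f, m, hf, hm, hfu, hadj, rfl⟩ := hS.exists_isInducedPath huS
  have hadj' : ∀ i ≤ m, ((G.Adj u (f i) ∨ ∃ S, G.IsHole S ∧ u ∈ S ∧ f i ∈ S) ↔ i = 0 ∨ i = m) := by
    intro i hi
    rw [← hadj i hi, localChordalize_adj]
    simp [(hfu i hi).symm]
  have hGadj : ∀ i j, i ≤ m → j ≤ m → (G.Adj (f i) (f j) ↔ i + 1 = j ∨ j + 1 = i) := by
    intro i j hi hj
    rw [← hf.adj i j hi hj, localChordalize_adj]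
    simp [hfu i hi, hfu j hj]
  have hfG : G.IsInducedPath f m := ⟨hf.inj, hGadj⟩
  refine hu.not_linked (K := f '' Set.Ioo 0 m) (a := f 0) (b := f m) ?_ (hfu 0 (by omega))
    (hfu m le_rfl) ?_ ?_ ?_ ?_ ((hadj' 0 (by omega)).2 (Or.inl rfl))
    ((hadj' m le_rfl).2 (Or.inr rfl))
  · rintro (h | h)
    · have := hf.inj _ _ (by omega) (by omega) h
      omega
    · rw [hGadj _ _ (by omega) le_rfl] at h
      omega
  · rintro ⟨i, hi, h⟩
    exact hfu i hi.2.le h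
  · rintro _ ⟨i, hi, rfl⟩ h
    have h1 := (hadj' i hi.2.le).1 (Or.inl h)
    have := hi.1
    have := hi.2
    omega
  · rintro S hS huS _ ⟨i, hi, rfl⟩ hiS
    have h1 := (hadj' i hi.2.le).1 (Or.inr ⟨S, hS, huS, hiS⟩)
    have := hi.1
    have := hi.2
    omega
  · refine hfG.linked_le (by omega) le_rfl fun l _ hl => ?_
    rcases Nat.eq_zero_or_pos l with rfl | h0
    · exact Or.inl rfl
    · rcases hl.eq_or_lt with rfl | h
      · exact Or.inr (Or.inl rfl)
      · exact Or.inr (Or.inr ⟨l, ⟨h0, h⟩, rfl⟩)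

theorem isHole_of_localChordalize {u : V} {S : Set V} (huS : u ∉ S)
    (hS : (G.localChordalize u).IsHole S) : G.IsHole S := by
  refine hS.congr fun x hx y hy => ?_
  rw [localChordalize_adj]
  simp only [or_iff_left_iff_imp]
  rintro ⟨-, rfl | rfl, -⟩
  exacts [absurd hx huS, absurd hy huS]

/-! ### Edges added by local chordalization -/

/-- `x` and `y` lie on a common hole and at least one of them belongs to `X`. -/
def ShareHole (G : SimpleGraph V) (X : Set V) (x y : V) : Prop :=
  (x ∈ X ∨ y ∈ X) ∧ ∃ S, G.IsHole S ∧ x ∈ S ∧ y ∈ S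

theorem ShareHole.symm {X : Set V} {x y : V} (h : G.ShareHole X x y) : G.ShareHole X y x := by
  obtain ⟨h, S, hS, hx, hy⟩ := h
  exact ⟨h.symm, S, hS, hy, hx⟩

/-- Successive local chordalizations create no new holes, so that every edge they add joins a
vertex of `X` to a vertex on a common hole of the original graph. The induction is on the list,
for all graphs `H` that occur on the way. -/
theorem foldl_localChordalize_adj {X : Set V} (hX : ∀ u ∈ X, G.VertexNC u) (l : List V)
    (hl : ∀ v ∈ l, v ∈ X) (H : SimpleGraph V)
    (hH : ∀ S, H.IsHole S → G.IsHole S ∧ ∀ x ∈ S, ∀ y ∈ S, H.Adj x y → G.Adj x y)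
    (hadj : ∀ x y, H.Adj x y → G.Adj x y ∨ G.ShareHole X x y) (x y : V)
    (hxy : (l.foldl localChordalize H).Adj x y) : G.Adj x y ∨ G.ShareHole X x y := by
  induction l generalizing H with
  | nil => exact hadj x y hxy
  | cons u l ih =>
    have huX : u ∈ X := hl u List.mem_cons_self
    have hu : H.VertexNC u := by
      rintro S T hS hT huS huT ⟨a, b, c, hac, hab, hbc, h1, h2⟩
      exact hX u huX S T (hH S hS).1 (hH T hT).1 huS huT
        ⟨a, b, c, hac, (hH S hS).2 a h1.1 b h1.2.1 hab, (hH S hS).2 b h1.2.1 c h1.2.2 hbc, h1, h2⟩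
    refine ih (fun v hv => hl v (List.mem_cons_of_mem _ hv)) _ (fun S hS => ?_) (fun a b hab => ?_)
      hxy
    · have huS := hu.notMem_of_isHole_localChordalize hS
      have hS' := isHole_of_localChordalize huS hS
      refine ⟨(hH S hS').1, fun a ha b hb hab => ?_⟩
      rw [localChordalize_adj] at hab
      rcases hab with h | ⟨-, rfl | rfl, -⟩
      exacts [(hH S hS').2 a ha b hb h, absurd ha huS, absurd hb huS]
    · rw [localChordalize_adj] at hab
      rcases hab with h | ⟨-, h, S, hS, ha, hb⟩
      · exact hadj a b h
      · refine Or.inr ⟨?_, S, (hH S hS).1, ha, hb⟩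
        rcases h with rfl | rfl
        exacts [Or.inl huX, Or.inr huX]

theorem IsLocalChordalization.adj {X : Set V} {G' : SimpleGraph V} (hX : G.SetNC X)
    (h : G.IsLocalChordalization X G') {x y : V} (hxy : G'.Adj x y) :
    G.Adj x y ∨ G.ShareHole X x y := by
  obtain ⟨l, -, hl, rfl⟩ := h
  exact foldl_localChordalize_adj hX.1 l (fun v hv => (hl v).1 hv) G
    (fun S hS => ⟨hS, fun _ _ _ _ h => h⟩) (fun _ _ h => Or.inl h) x y hxy

/-- The neighbours on a hole `T` of a vertex `u ∉ T` with the NC property are pairwise adjacent,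
unless `u` is adjacent to the whole of `T`: if `u` is not adjacent to `w`, one of the two arcs of
`T` between non-adjacent neighbours of `u` closes up with `u` to a hole through `w`. -/
theorem VertexNC.touch_of_adj {u : V} (hu : G.VertexNC u) {T : Set V} (hT : G.IsHole T)
    (huT : u ∉ T) {w : V} (hw : w ∈ T) (huw : ¬ G.Adj u w) {p q : V} (hp : p ∈ T) (hq : q ∈ T)
    (hup : G.Adj u p) (huq : G.Adj u q) : G.Touch p q := by
  by_contra hpq
  obtain ⟨f, m, hf, hm, hfw, hadj, rfl⟩ := hT.exists_isInducedPath hw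
  have hmem : ∀ i ≤ m, f i ∈ insert w (f '' Set.Iic m) := fun i h =>
    Or.inr (Set.mem_image_of_mem f h)
  obtain rfl | ⟨i, hi, rfl⟩ := hp
  · exact huw hup
  obtain rfl | ⟨j, hj, rfl⟩ := hq
  · exact huw huq
  have hi : i ≤ m := hi
  have hj : j ≤ m := hj
  wlog hij : i ≤ j generalizing i j
  · exact this j hj huq i hi hup (fun h => hpq h.symm) hj hi (by omega)
  have hij' : i + 1 < j := by
    by_contra h
    obtain rfl | rfl : j = i ∨ j = i + 1 := by omega
    · exact hpq (Or.inl rfl)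
    · exact hpq (Or.inr ((hf.adj _ _ hi hj).2 (Or.inl rfl)))
  have huf : ∀ l ≤ m, f l ≠ u := fun l hl h => huT (h ▸ hmem l hl)
  have hl : G.Linked ((f '' Set.Icc 0 i) ∪ {u} ∪ (f '' Set.Icc j m)) (f 0) (f m) := by
    have h1 : G.Linked ((f '' Set.Icc 0 i) ∪ {u} ∪ (f '' Set.Icc j m)) (f 0) (f i) :=
      hf.linked_le (by omega) hi fun l h1 h2 => Or.inl (Or.inl ⟨l, ⟨h1, h2⟩, rfl⟩)
    have h2 : G.Linked ((f '' Set.Icc 0 i) ∪ {u} ∪ (f '' Set.Icc j m)) (f j) (f m) :=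
      hf.linked_le hj le_rfl fun l h1 h2 => Or.inr ⟨l, ⟨h1, h2⟩, rfl⟩
    exact ((h1.trans (.of_adj hup.symm (Or.inl (Or.inl ⟨i, ⟨by omega, le_rfl⟩, rfl⟩))
      (Or.inl (Or.inr rfl)))).trans (.of_adj huq (Or.inl (Or.inr rfl))
      (Or.inr ⟨j, ⟨le_rfl, hj⟩, rfl⟩))).trans h2
  have h0w := (hadj 0 (by omega)).2 (Or.inl rfl)
  have hmw := (hadj m le_rfl).2 (Or.inr rfl)
  obtain ⟨Z, hZ, hwZ, h0Z, hmZ, v, huZ, hv⟩ := hl.exists_isHole_inter (v := w)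
    (by
      rintro ((⟨l, h, hl⟩ | h) | ⟨l, h, hl⟩)
      · exact hfw l (h.2.trans hi) hl
      · exact huT (h ▸ Set.mem_insert _ _)
      · exact hfw l h.2 hl)
    ⟨0, ⟨le_rfl, by omega⟩, rfl⟩ ⟨m, ⟨hj, le_rfl⟩, rfl⟩ h0w hmw
    (by
      rintro _ ⟨a, ha, rfl⟩ _ ⟨b, hb, rfl⟩ h
      have := ha.2
      have := hb.1
      rcases h with h | h
      · have := hf.inj _ _ (by omega) hb.2 h
        omega
      · rw [hf.adj _ _ (by omega) hb.2] at h
        omega)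
    (by
      have aux : ∀ l ≤ m, G.Adj w (f l) → f l = f 0 ∨ f l = f m := fun l hl h =>
        ((hadj l hl).1 h).imp (congrArg f) (congrArg f)
      rintro c ((⟨l, h, rfl⟩ | rfl) | ⟨l, h, rfl⟩) hc
      · exact aux l (h.2.trans hi) hc
      · exact absurd hc.symm huw
      · exact aux l h.2 hc)
  obtain rfl : v = u := hv
  refine hu Z _ hZ hT huZ huT ⟨f 0, w, f m, fun h => ?_, h0w.symm, hmw, ⟨h0Z, hwZ, hmZ⟩,
    hmem 0 (by omega), Set.mem_insert _ _, hmem m le_rfl⟩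
  have := hf.inj _ _ (by omega) le_rfl h
  omega

/-- The two neighbours `s`, `s'` of a vertex `v` on a hole, and the two paths of the hole that
start at `s` and at `s'` and stop before reaching `s'` and `s`. -/
theorem IsHole.exists_neighbors {S : Set V} (hS : G.IsHole S) {v : V} (hv : v ∈ S) :
    ∃ s ∈ S, ∃ s' ∈ S, ¬ G.Touch s s' ∧ G.Adj v s ∧ G.Adj v s' ∧
      (∀ c ∈ S, G.Adj v c → c = s ∨ c = s') ∧
      (∀ w ∈ S, w ≠ v → w ≠ s' → G.Linked (S \ {v, s'}) s w) ∧
      (∀ w ∈ S, w ≠ v → w ≠ s → G.Linked (S \ {v, s}) s' w) := by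
  obtain ⟨f, m, hf, hm, hfv, hadj, rfl⟩ := hS.exists_isInducedPath hv
  have hmem : ∀ i ≤ m, f i ∈ insert v (f '' Set.Iic m) := fun i h =>
    Or.inr (Set.mem_image_of_mem f h)
  refine ⟨f 0, hmem 0 (by omega), f m, hmem m le_rfl, ?_, (hadj 0 (by omega)).2 (Or.inl rfl),
    (hadj m le_rfl).2 (Or.inr rfl), ?_, ?_, ?_⟩
  · rintro (h | h)
    · have := hf.inj _ _ (by omega) le_rfl h
      omega
    · rw [hf.adj _ _ (by omega) le_rfl] at h
      omega
  · rintro c (rfl | ⟨l, hl, rfl⟩) hc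
    · exact absurd hc (G.irrefl)
    · exact ((hadj l hl).1 hc).imp (congrArg f) (congrArg f)
  · rintro w (rfl | ⟨l, hl, rfl⟩) hw hw'
    · exact absurd rfl hw
    · have hl : l ≤ m := hl
      have hlm : l ≠ m := fun h => hw' (congrArg f h)
      refine hf.linked_le (by omega) hl fun k _ hk => ⟨hmem k (by omega), fun h => ?_⟩
      have h := h.resolve_left (hfv k (by omega))
      have := hf.inj k m (by omega) le_rfl h
      omega
  · rintro w (rfl | ⟨l, hl, rfl⟩) hw hw'
    · exact absurd rfl hw
    · have hl : l ≤ m := hl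
      have hlm : l ≠ 0 := fun h => hw' (congrArg f h)
      refine Linked.symm (hf.linked_le hl le_rfl fun k hk hkm => ⟨hmem k hkm, fun h => ?_⟩)
      have h := h.resolve_left (hfv k hkm)
      have := hf.inj k 0 (by omega) (by omega) h
      omega

/-- If adjacent vertices `u`, `u'` of `X` were each on a common hole with `w` without being
adjacent to it, then the two holes would contain, together with the edge `u u'`, a hole through
both `u` and `u'`. -/
theorem SetNC.not_adj_of_isHole {X : Set V} (hX : G.SetNC X) {u u' w : V} (hu : u ∈ X)
    (hu' : u' ∈ X) {S T : Set V} (hS : G.IsHole S) (hT : G.IsHole T) (huS : u ∈ S) (hwS : w ∈ S)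
    (huT : u' ∈ T) (hwT : w ∈ T) (huw : ¬ G.Touch u w) (huw' : ¬ G.Touch u' w) :
    ¬ G.Adj u u' := by
  intro huu
  have hu'S : u' ∉ S := fun h => huu.ne (hX.2 S hS ⟨huS, hu⟩ ⟨h, hu'⟩)
  have huT' : u ∉ T := fun h => huu.ne (hX.2 T hT ⟨h, hu⟩ ⟨huT, hu'⟩)
  obtain ⟨s, s', hsS, hss, hus, hus', hsu', hSonly, hSl⟩ : ∃ s s', s ∈ S ∧ s ≠ s' ∧ G.Adj u s ∧
      G.Adj u s' ∧ ¬ G.Adj u' s ∧ (∀ c ∈ S, G.Adj u c → c = s ∨ c = s') ∧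
      (∀ w ∈ S, w ≠ u → w ≠ s' → G.Linked (S \ {u, s'}) s w) := by
    obtain ⟨s, hs, s', hs', hss, h1, h2, h3, h4, h5⟩ := hS.exists_neighbors huS
    by_cases h : G.Adj u' s
    · refine ⟨s', s, hs', fun h' => hss (Or.inl h'.symm), h2, h1, fun h' => hss ?_,
        fun c hc hc' => (h3 c hc hc').symm, h5⟩
      exact (hX.1 u' hu').touch_of_adj hS hu'S hwS (fun h => huw' (Or.inr h)) hs hs' h h'
    · exact ⟨s, s', hs, fun h' => hss (Or.inl h'), h1, h2, h, h3, h4⟩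
  obtain ⟨t, t', htT, htt, hut, hut', htu, hTonly, hTl⟩ : ∃ t t', t ∈ T ∧ t ≠ t' ∧ G.Adj u' t ∧
      G.Adj u' t' ∧ ¬ G.Adj u t ∧ (∀ c ∈ T, G.Adj u' c → c = t ∨ c = t') ∧
      (∀ w ∈ T, w ≠ u' → w ≠ t' → G.Linked (T \ {u', t'}) t w) := by
    obtain ⟨s, hs, s', hs', hss, h1, h2, h3, h4, h5⟩ := hT.exists_neighbors huT
    by_cases h : G.Adj u s
    · refine ⟨s', s, hs', fun h' => hss (Or.inl h'.symm), h2, h1, fun h' => hss ?_,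
        fun c hc hc' => (h3 c hc hc').symm, h5⟩
      exact (hX.1 u hu).touch_of_adj hT huT' hwT (fun h => huw (Or.inr h)) hs hs' h h'
    · exact ⟨s, s', hs, fun h' => hss (Or.inl h'), h1, h2, h, h3, h4⟩
  set C : Set V := insert u (S \ {u, s'} ∪ T \ {u', t'}) with hC
  have hwt : w ≠ t' := fun h => huw' (Or.inr (h ▸ hut'))
  have hws : w ≠ s' := fun h => huw (Or.inr (h ▸ hus'))
  have huC : u ∈ C := Set.mem_insert _ _
  have htC : t ∈ C := Or.inr (Or.inr ⟨htT, by
    rintro (h | h)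
    exacts [hut.ne h.symm, htt h]⟩)
  have hl : G.Linked C u t := by
    exact ((Linked.of_adj hus huC (Or.inr (Or.inl ⟨hsS, by
      rintro (h | h)
      exacts [hus.ne h.symm, hss h]⟩))).trans
      ((hSl w hwS (fun h => huw (Or.inl h.symm)) hws).mono fun x hx => Or.inr (Or.inl hx))).trans
      ((hTl w hwT (fun h => huw' (Or.inl h.symm)) hwt).mono fun x hx => Or.inr (Or.inr hx)).symm
  obtain ⟨Z, hZ, hu'Z, huZ, -⟩ := hl.exists_isHole (v := u') (by
      rintro (h | h | h)
      · exact huu.ne h.symm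
      · exact hu'S h.1
      · exact h.2 (Or.inl rfl)) htC huu.symm hut (by
      rintro (h | h)
      · exact huT' (h ▸ htT)
      · exact htu h) (by
      rintro c (h | h | h) hc
      · exact Or.inl h
      · -- a neighbour of `u'` on the first hole touches `u`, hence is one of `u`, `s`, `s'`
        rcases (hX.1 u' hu').touch_of_adj hS hu'S hwS (fun h => huw' (Or.inr h)) huS h.1 huu.symm hc
          with h' | h'
        · exact Or.inl h'.symm
        · rcases hSonly c h.1 h' with rfl | rfl
          · exact absurd hc hsu'
          · exact absurd (Or.inr rfl) h.2
      · exact Or.inr ((hTonly c h.1 hc).resolve_right fun h' => h.2 (Or.inr h')))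
  exact huu.ne (hX.2 Z hZ ⟨huZ, hu⟩ ⟨hu'Z, hu'⟩)

/-- Let `X` have the NC property in `A`, and let `R` agree with `A` on the vertices of holes of
`A`. If any two vertices of `K` are adjacent in `R` or share a hole of `A`, one of them being in
`X`, then deleting a single vertex from `K` leaves a clique of `R`. The pairs of `K` that are not
adjacent in `R` have exactly one member in `X` and pairwise intersect, hence form a star. -/
theorem SetNC.exists_pairwise_diff_singleton {A R : SimpleGraph V} {X : Set V} (hX : A.SetNC X)
    (hR : ∀ S T, A.IsHole S → A.IsHole T → ∀ x ∈ S, ∀ y ∈ T, R.Adj x y → A.Adj x y)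
    (hAR : A ≤ R) {K : Set V} (hne : K.Nonempty)
    (hK : K.Pairwise fun x y => R.Adj x y ∨ A.ShareHole X x y) :
    ∃ c ∈ K, (K \ {c}).Pairwise R.Adj := by
  -- a pair of the second kind, ordered so that its first member is in `X`
  let New : V → V → Prop := fun u w => u ∈ K ∧ w ∈ K ∧ u ≠ w ∧ ¬ R.Adj u w ∧ u ∈ X ∧
    ∃ S, A.IsHole S ∧ u ∈ S ∧ w ∈ S
  have hnew : ∀ x ∈ K, ∀ y ∈ K, x ≠ y → ¬ R.Adj x y → New x y ∨ New y x := by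
    intro x hx y hy hxy hadj
    obtain ⟨h, S, hS, hxS, hyS⟩ := (hK hx hy hxy).resolve_left hadj
    rcases h with h | h
    · exact Or.inl ⟨hx, hy, hxy, hadj, h, S, hS, hxS, hyS⟩
    · exact Or.inr ⟨hy, hx, hxy.symm, fun h' => hadj h'.symm, h, S, hS, hyS, hxS⟩
  have hnotX : ∀ {u w}, New u w → w ∉ X := by
    rintro u w ⟨-, -, huw, -, hu, S, hS, huS, hwS⟩ hw
    exact huw (hX.2 S hS ⟨huS, hu⟩ ⟨hwS, hw⟩)
  -- two disjoint such pairs would give a hole with two vertices in `X`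
  have hmeet : ∀ {u w u' w'}, New u w → New u' w' → u = u' ∨ w = w' := by
    intro u w u' w' h h'
    by_contra! hne
    have hwX := hnotX h
    have hwX' := hnotX h'
    obtain ⟨huK, hwK, huw, hadj, hu, S, hS, huS, hwS⟩ := h
    obtain ⟨huK', hwK', huw', hadj', hu', S', hS', huS', hwS'⟩ := h'
    have huu : A.Adj u u' := by
      rcases hK huK huK' hne.1 with h | ⟨-, T, hT, h1, h2⟩
      · exact hR S S' hS hS' u huS u' huS' h
      · exact absurd (hX.2 T hT ⟨h1, hu⟩ ⟨h2, hu'⟩) hne.1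
    have hww : A.Adj w w' := by
      rcases hK hwK hwK' hne.2 with h | ⟨h, -⟩
      · exact hR S S' hS hS' w hwS w' hwS' h
      · exact absurd h (by simp [hwX, hwX'])
    have huwA : ¬ A.Touch u w := by
      rintro (h | h)
      exacts [huw h, hadj (hAR h)]
    have huwA' : ¬ A.Touch u' w' := by
      rintro (h | h)
      exacts [huw' h, hadj' (hAR h)]
    have hcross : A.Adj u w' := by
      by_contra hno
      rcases hK huK hwK' (fun h => hwX' (h ▸ hu)) with h | ⟨-, T, hT, h1, h2⟩
      · exact hno (hR S S' hS hS' u huS w' hwS' h)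
      · refine hX.not_adj_of_isHole hu hu' hT hS' h1 h2 huS' hwS' ?_ huwA' huu
        rintro (h | h)
        exacts [hwX' (h ▸ hu), hno h]
    have hcross' : A.Adj u' w := by
      by_contra hno
      rcases hK huK' hwK (fun h => hwX (h ▸ hu')) with h | ⟨-, T, hT, h1, h2⟩
      · exact hno (hR S' S hS' hS u' huS' w hwS h)
      · refine hX.not_adj_of_isHole hu' hu hT hS h1 h2 huS hwS ?_ huwA huu.symm
        rintro (h | h)
        exacts [hwX (h ▸ hu'), hno h]
    have hl : A.Linked {u', w, w'} u' w' :=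
      (Linked.of_adj hcross' (by simp) (by simp)).trans (.of_adj hww (by simp) (by simp))
    obtain ⟨Z, hZ, huZ, hu'Z, -⟩ := hl.exists_isHole (v := u) (by
        rintro (h | h | h)
        exacts [hne.1 h, huw h, hwX' (h ▸ hu)]) (by simp) huu hcross huwA' (by
        rintro c (h | h | h) hc
        · exact Or.inl h
        · exact absurd (Or.inr (h ▸ hc)) huwA
        · exact Or.inr h)
    exact hne.1 (hX.2 Z hZ ⟨huZ, hu⟩ ⟨hu'Z, hu'⟩)
  suffices h : ∃ c ∈ K, ∀ u w, New u w → u = c ∨ w = c by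
    obtain ⟨c, hcK, hc⟩ := h
    refine ⟨c, hcK, fun x hx y hy hxy => ?_⟩
    by_contra hadj
    rcases hnew x hx.1 y hy.1 hxy hadj with h | h <;> rcases hc _ _ h with h | h
    exacts [hx.2 h, hy.2 h, hy.2 h, hx.2 h]
  by_cases hex : ∃ u w u' w', New u w ∧ New u' w' ∧ u ≠ u'
  · obtain ⟨u, w, u', w', h, h', hne⟩ := hex
    have hw := (hmeet h h').resolve_left hne
    refine ⟨w, h.2.1, fun a b hab => ?_⟩
    by_contra! hc
    exact hne (((hmeet hab h).resolve_right hc.2).symm.trans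
      ((hmeet hab h').resolve_right (hw ▸ hc.2)))
  · push Not at hex
    by_cases hex' : ∃ u w, New u w
    · obtain ⟨u, w, h⟩ := hex'
      exact ⟨u, h.1, fun a b hab => Or.inl (hex a b u w hab h)⟩
    · push Not at hex'
      obtain ⟨v, hv⟩ := hne
      exact ⟨v, hv, fun a b hab => absurd hab (hex' a b)⟩

/-! ### Complete minors from holes -/

theorem Linked.eq_or_mem {C : Set V} {s t : V} (h : G.Linked C s t) : t = s ∨ t ∈ C := by
  cases h with
  | refl => exact Or.inl rfl
  | tail _ h => exact Or.inr h.2.2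

theorem induce_linked_connected (C : Set V) (s : V) :
    (G.induce {v | G.Linked C s v}).Connected := by
  have key : ∀ v (hv : G.Linked C s v),
      (G.induce {v | G.Linked C s v}).Reachable ⟨s, Linked.refl s⟩ ⟨v, hv⟩ := by
    intro v hv
    induction hv with
    | refl => exact Reachable.refl _
    | @tail b d hb hbd ih =>
      refine ih.trans (Adj.reachable ?_)
      exact hbd.1
  have : Nonempty {v | G.Linked C s v} := ⟨⟨s, Linked.refl s⟩⟩
  exact ⟨fun x y => (key x.1 x.2).symm.trans (key y.1 y.2)⟩

/-- Suppose that `K \ {c}` is a clique, every vertex of which is adjacent to `c` or on a common hole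
with `c`. Since a hole meets a clique in at most two vertices, which are consecutive, one of its two
paths from `c` to `x ∈ K` meets `K` in `c` and `x` only. Hence `K \ {c}` together with the component
of `c` in the complement of `K \ {c}` are the branch sets of a complete minor. -/
theorem isMinor_completeGraph {K : Finset V} {c : V} (hc : c ∈ K)
    (hK : ((K : Set V) \ {c}).Pairwise G.Adj)
    (hcK : ∀ x ∈ K, x ≠ c → G.Adj c x ∨ ∃ S, G.IsHole S ∧ c ∈ S ∧ x ∈ S) {n : ℕ}
    (hn : n ≤ K.card) : (completeGraph (Fin n)).IsMinor G := by
  classical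
  set U : Set V := {v | G.Linked ((K : Set V) \ {c})ᶜ c v} with hU
  have hcU : c ∈ U := Linked.refl c
  have hUK : ∀ v ∈ U, v ∈ K → v = c := by
    intro v hv hvK
    rcases Linked.eq_or_mem hv with h | h
    · exact h
    · by_contra hvc
      exact h ⟨hvK, hvc⟩
  have hnbr : ∀ x ∈ K, x ≠ c → ∃ y ∈ U, G.Adj y x := by
    intro x hx hxc
    by_cases hcx : G.Adj c x
    · exact ⟨c, hcU, hcx⟩
    obtain ⟨S, hS, hcS, hxS⟩ := (hcK x hx hxc).resolve_left hcx
    obtain ⟨f, m, hf, hm, hfc, hadj, rfl⟩ := hS.exists_isInducedPath hcS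
    obtain rfl | ⟨i, hi, rfl⟩ := hxS
    · exact absurd rfl hxc
    have hi : i ≤ m := hi
    rw [hadj i hi] at hcx
    have hfK : ∀ j ≤ m, f j ∈ K → j ≠ i → j + 1 = i ∨ i + 1 = j := by
      intro j hj hjK hji
      rw [← hf.adj j i hj hi]
      exact hK ⟨hjK, hfc j hj⟩ ⟨hx, hfc i hi⟩ fun h => hji (hf.inj j i hj hi h)
    have hcmem : c ∈ ((K : Set V) \ {c})ᶜ := fun h => h.2 rfl
    by_cases h1 : f (i - 1) ∈ K
    · have h2 : f (i + 1) ∉ K := by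
        intro h2
        have h := hK ⟨h1, hfc _ (by omega)⟩ ⟨h2, hfc _ (by omega)⟩ fun h => by
          have := hf.inj _ _ (by omega) (by omega) h
          omega
        rw [hf.adj _ _ (by omega) (by omega)] at h
        omega
      have hout : ∀ l, i + 1 ≤ l → l ≤ m → f l ∈ ((K : Set V) \ {c})ᶜ := by
        rintro l hl hlm ⟨h, -⟩
        rcases hfK l hlm h (by omega) with h' | h'
        · omega
        · exact h2 (h' ▸ h)
      refine ⟨f (i + 1), ?_, (hf.adj _ _ (by omega) hi).2 (by omega)⟩
      exact (Linked.of_adj ((hadj m le_rfl).2 (Or.inr rfl)) hcmem (hout m (by omega) le_rfl)).trans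
        (hf.linked_le (by omega) le_rfl hout).symm
    · have hout : ∀ l, 0 ≤ l → l ≤ i - 1 → f l ∈ ((K : Set V) \ {c})ᶜ := by
        rintro l - hl ⟨h, -⟩
        rcases hfK l (by omega) h (by omega) with h' | h'
        · obtain rfl : l = i - 1 := by omega
          exact h1 h
        · omega
      refine ⟨f (i - 1), ?_, (hf.adj _ _ (by omega) hi).2 (by omega)⟩
      exact (Linked.of_adj ((hadj 0 (by omega)).2 (Or.inl rfl)) hcmem
        (hout 0 le_rfl (by omega))).trans (hf.linked_le (by omega) (by omega) hout)
  let e : Fin n → V := fun i => (K.equivFin.symm (Fin.castLE hn i)).1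
  have heK : ∀ i, e i ∈ K := fun i => (K.equivFin.symm (Fin.castLE hn i)).2
  have he : Function.Injective e := fun i j h =>
    Fin.castLE_injective hn (K.equivFin.symm.injective (Subtype.ext h))
  refine ⟨fun i => if e i = c then U else {e i}, fun i => ?_, fun i j hij => ?_, fun i j hij => ?_⟩
  · change (G.induce (if e i = c then U else {e i})).Connected
    by_cases h : e i = c
    · rw [if_pos h]
      exact induce_linked_connected _ _
    · rw [if_neg h]
      exact ⟨fun x y => by rw [Subsingleton.elim x y]⟩
  · have hne := fun h => hij (he h)
    change Disjoint (if e i = c then U else {e i}) (if e j = c then U else {e j})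
    rw [Set.disjoint_left]
    split_ifs with h1 h2 h2
    · exact absurd (h1.trans h2.symm) hne
    · rintro x hx rfl
      exact h2 (hUK _ hx (heK j))
    · rintro x rfl hx
      exact h1 (hUK _ hx (heK i))
    · rintro x rfl h
      exact hne h
  · have hne : e i ≠ e j := fun h => hij.ne (he h)
    dsimp only
    split_ifs with h1 h2 h2
    · exact absurd (h1.trans h2.symm) hne
    · obtain ⟨y, hy, hadj⟩ := hnbr _ (heK j) h2
      exact ⟨y, hy, _, rfl, hadj⟩
    · obtain ⟨y, hy, hadj⟩ := hnbr _ (heK i) h1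
      exact ⟨_, rfl, y, hy, hadj.symm⟩
    · exact ⟨_, rfl, _, rfl, hK ⟨heK i, h1⟩ ⟨heK j, h2⟩ hne⟩

/-! ### Cliques in the completions of a local chordalization partition -/

section Partition

variable {X : Set V} {k : ℕ} {P : Fin k → Set V} {A : Fin k → SimpleGraph V}
  {B : Fin (k + 1) → SimpleGraph V}

/-- The vertices of a part are isolated in the completions that precede it. -/
theorem notMem_part_of_adj (hPX : ∀ j, P j ⊆ X) (h0 : B 0 = G.deleteVerts X)
    (hA : ∀ i : Fin k, A i = B i.castSucc ⊔ G.deleteVerts (⋃ j ∈ Set.Ioi i, P j))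
    (hNC : ∀ i, (A i).SetNC (P i))
    (hB : ∀ i : Fin k, (A i).IsLocalChordalization (P i) (B i.succ)) (i : Fin (k + 1)) :
    ∀ x y, (B i).Adj x y → ∀ j : Fin k, i ≤ j.castSucc → x ∉ P j := by
  induction i using Fin.induction with
  | zero =>
    intro x y h j _ hx
    rw [h0, deleteVerts_adj] at h
    exact h.2.1 (hPX j hx)
  | succ i ih =>
    intro x y h j hij hx
    have hij : i < j := hij
    obtain ⟨z, hz⟩ : ∃ z, (A i).Adj x z := by
      rcases (hB i).adj (hNC i) h with h | ⟨-, S, hS, hxS, -⟩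
      · exact ⟨y, h⟩
      · exact hS.exists_adj hxS
    rw [hA, sup_adj, deleteVerts_adj] at hz
    rcases hz with h | h
    · exact ih x z h j (Fin.castSucc_le_castSucc_iff.2 hij.le) hx
    · exact h.2.1 (Set.mem_biUnion hij hx)

theorem notMem_later_of_isHole (hPX : ∀ j, P j ⊆ X) (h0 : B 0 = G.deleteVerts X)
    (hA : ∀ i : Fin k, A i = B i.castSucc ⊔ G.deleteVerts (⋃ j ∈ Set.Ioi i, P j))
    (hNC : ∀ i, (A i).SetNC (P i))
    (hB : ∀ i : Fin k, (A i).IsLocalChordalization (P i) (B i.succ)) (i : Fin k) {S : Set V}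
    (hS : (A i).IsHole S) {x : V} (hx : x ∈ S) : x ∉ ⋃ j ∈ Set.Ioi i, P j := by
  intro hxj
  obtain ⟨y, hy⟩ := hS.exists_adj hx
  rw [hA, sup_adj, deleteVerts_adj] at hy
  rcases hy with h | h
  · simp only [Set.mem_iUnion] at hxj
    obtain ⟨j, hij, hxj⟩ := hxj
    exact notMem_part_of_adj hPX h0 hA hNC hB _ x y h j
      (Fin.castSucc_le_castSucc_iff.2 (le_of_lt hij)) hxj
  · exact h.2.1 hxj

theorem adj_or_shareHole_of_completion_adj (hNC : ∀ i, (A i).SetNC (P i))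
    (hA : ∀ i : Fin k, A i = B i.castSucc ⊔ G.deleteVerts (⋃ j ∈ Set.Ioi i, P j))
    (hB : ∀ i : Fin k, (A i).IsLocalChordalization (P i) (B i.succ)) (i : Fin k) {x y : V}
    (h : (B i.succ ⊔ G).Adj x y) : (B i.castSucc ⊔ G).Adj x y ∨ (A i).ShareHole (P i) x y := by
  rcases h with h | h
  · refine ((hB i).adj (hNC i) h).imp_left fun h => ?_
    rw [hA, sup_adj, deleteVerts_adj] at h
    exact h.imp_right fun h => h.1
  · exact Or.inl (Or.inr h)

/-- Going back by one completion costs a clique at most one vertex. The edges of `G` are added to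
every completion so that the vertices of the later parts can stay in the clique. -/
theorem exists_pairwise_diff_singleton_of_completion (hPX : ∀ j, P j ⊆ X)
    (h0 : B 0 = G.deleteVerts X)
    (hA : ∀ i : Fin k, A i = B i.castSucc ⊔ G.deleteVerts (⋃ j ∈ Set.Ioi i, P j))
    (hNC : ∀ i, (A i).SetNC (P i))
    (hB : ∀ i : Fin k, (A i).IsLocalChordalization (P i) (B i.succ)) (i : Fin k) {K : Set V}
    (hne : K.Nonempty) (hK : K.Pairwise (B i.succ ⊔ G).Adj) :
    ∃ c ∈ K, (K \ {c}).Pairwise (B i.castSucc ⊔ G).Adj := by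
  refine (hNC i).exists_pairwise_diff_singleton (fun S T hS hT x hx y hy h => ?_) ?_ hne
    fun x hx y hy hxy => adj_or_shareHole_of_completion_adj hNC hA hB i (hK hx hy hxy)
  · rw [hA, sup_adj, deleteVerts_adj]
    exact h.imp_right fun h => ⟨h, notMem_later_of_isHole hPX h0 hA hNC hB i hS hx,
      notMem_later_of_isHole hPX h0 hA hNC hB i hT hy⟩
  · rw [hA]
    intro x y h
    rw [sup_adj, deleteVerts_adj] at h
    exact h.imp_right fun h => h.1

/-- Going back from the completion `B i` to `B j` costs a clique at most `i - j` vertices. -/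
theorem exists_subset_pairwise_completion (hPX : ∀ j, P j ⊆ X) (h0 : B 0 = G.deleteVerts X)
    (hA : ∀ i : Fin k, A i = B i.castSucc ⊔ G.deleteVerts (⋃ j ∈ Set.Ioi i, P j))
    (hNC : ∀ i, (A i).SetNC (P i))
    (hB : ∀ i : Fin k, (A i).IsLocalChordalization (P i) (B i.succ)) (j i : Fin (k + 1))
    (hji : j ≤ i) (K : Finset V) (hK : (K : Set V).Pairwise (B i ⊔ G).Adj) :
    ∃ K' ⊆ K, K.card + j.val ≤ K'.card + i.val ∧ (K' : Set V).Pairwise (B j ⊔ G).Adj := by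
  classical
  induction i using Fin.induction generalizing K with
  | zero =>
    obtain rfl : j = 0 := Fin.le_zero_iff.1 hji
    exact ⟨K, subset_rfl, le_rfl, hK⟩
  | succ i ih =>
    rcases hji.eq_or_lt with rfl | hji
    · exact ⟨K, subset_rfl, le_rfl, hK⟩
    rcases K.eq_empty_or_nonempty with rfl | hne
    · exact ⟨∅, subset_rfl, Nat.add_le_add_left (le_of_lt hji) _, by simp⟩
    obtain ⟨c, hcK, hc⟩ := exists_pairwise_diff_singleton_of_completion hPX h0 hA hNC hB i
      (Finset.coe_nonempty.2 hne) hK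
    obtain ⟨K', hK', hcard, hpw⟩ := ih (Fin.le_castSucc_iff.2 hji) (K.erase c)
      (by rwa [Finset.coe_erase])
    refine ⟨K', hK'.trans (Finset.erase_subset _ _), ?_, hpw⟩
    have h1 := Finset.card_erase_add_one (Finset.mem_coe.1 hcK)
    simp only [Fin.val_castSucc, Fin.val_succ] at hcard ⊢
    omega

end Partition

/-- A local chordalization partition of `G` into `k` parts gives a chordal graph containing `G`
whose cliques have at most `k` more vertices than those of `G`. If moreover `G` has no
complete minor on `n` vertices, they have at most `n - 2 + k` vertices, because deleting `k - 1`
vertices leaves a clique of the first completion, whose added edges come from holes of `G` itself. -/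
theorem IsLocalChordalizationPartition.exists_chordal [Finite V] {X : Set V} {k : ℕ}
    {P : Fin k → Set V} (h : G.IsLocalChordalizationPartition X P) :
    ∃ H : SimpleGraph V, G ≤ H ∧ H.IsChordal ∧
      (∀ K : Finset V, H.IsClique K → K.card ≤ G.cliqueNum + k) ∧
      ∀ n : ℕ, ¬ (completeGraph (Fin n)).IsMinor G →
        ∀ K : Finset V, H.IsClique K → K.card + 2 ≤ n + k := by
  obtain ⟨hX, hPne, -, hPX', A, B, h0, hAB⟩ := h
  have hPX : ∀ j, P j ⊆ X := fun j => hPX' ▸ Set.subset_iUnion P j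
  have hk : 0 < k := by
    obtain ⟨x, hx⟩ := hX.1
    rw [← hPX'] at hx
    obtain ⟨j, -⟩ := Set.mem_iUnion.1 hx
    exact j.pos
  obtain ⟨k, rfl⟩ : ∃ k', k = k' + 1 := ⟨k - 1, by omega⟩
  have hA := fun i => (hAB i).1
  have hNC := fun i => (hAB i).2.2.1
  have hB := fun i => (hAB i).2.2.2.1
  have hG0 : ∀ {x y}, (B 0 ⊔ G).Adj x y → G.Adj x y := by
    rintro x y (h | h)
    · rw [h0, deleteVerts_adj] at h
      exact h.1
    · exact h
  have hGle : G ≤ B (Fin.last _) := by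
    rw [← Fin.succ_last]
    intro x y h
    obtain ⟨l, -, -, hl⟩ := hB (Fin.last k)
    have hle : ∀ (l : List V) (H : SimpleGraph V), H ≤ l.foldl localChordalize H := by
      intro l
      induction l with
      | nil => exact fun H => le_rfl
      | cons u l ih => exact fun H => le_trans le_sup_left (ih _)
    rw [hl]
    refine hle l _ ?_
    rw [hA, sup_adj, deleteVerts_adj]
    refine Or.inr ⟨h, ?_, ?_⟩ <;>
    · simp only [Set.mem_iUnion, not_exists]
      exact fun j hj => absurd hj (not_lt.2 (Fin.le_last j))
  refine ⟨B (Fin.last _), hGle, ?_, fun K hK => ?_, fun n hn K hK => ?_⟩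
  · rw [← Fin.succ_last]
    exact (hAB (Fin.last k)).2.2.2.2
  · obtain ⟨K', -, hcard, hK'⟩ := exists_subset_pairwise_completion hPX h0 hA hNC hB 0 (Fin.last _)
      (Fin.zero_le _) K (hK.mono' fun _ _ h => Or.inl h)
    have hcl : G.IsClique K' := fun x hx y hy hxy => hG0 (hK' hx hy hxy)
    have := hcl.card_le_cliqueNum
    simp only [Fin.val_zero, Fin.val_last] at hcard
    omega
  · obtain ⟨K', -, hcard, hK'⟩ := exists_subset_pairwise_completion hPX h0 hA hNC hB (Fin.succ 0)
      (Fin.last _) (Fin.le_last _) K (hK.mono' fun _ _ h => Or.inl h)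
    simp only [Fin.val_succ, Fin.val_zero, Fin.val_last] at hcard
    have hlt : K'.card < n := by
      by_contra hle
      apply hn
      rcases K'.eq_empty_or_nonempty with rfl | hne
      · obtain rfl : n = 0 := by simpa using hle
        exact ⟨fun i => i.elim0, fun i => i.elim0, fun i => i.elim0, fun i => i.elim0⟩
      obtain ⟨c, hc, hcK⟩ := exists_pairwise_diff_singleton_of_completion hPX h0 hA hNC hB 0
        (Finset.coe_nonempty.2 hne) hK'
      refine isMinor_completeGraph hc (fun x hx y hy hxy => hG0 (hcK hx hy hxy))
        (fun x hx hxc => ?_) (not_lt.1 hle)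
      rcases adj_or_shareHole_of_completion_adj hNC hA hB 0 (hK' hc hx hxc.symm) with
        h | ⟨-, S, hS, hcS, hxS⟩
      · exact Or.inl (hG0 h)
      · -- on its holes, the graph in which the first part is restored agrees with `G`
        refine Or.inr ⟨S, hS.congr fun a ha b hb => ⟨fun h => ?_, fun h => ?_⟩, hcS, hxS⟩
        · rw [hA, sup_adj, deleteVerts_adj] at h
          exact h.elim (fun h => hG0 (Or.inl h)) fun h => h.1
        · rw [hA, sup_adj, deleteVerts_adj]
          exact Or.inr ⟨h, notMem_later_of_isHole hPX h0 hA hNC hB 0 hS ha,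
            notMem_later_of_isHole hPX h0 hA hNC hB 0 hS hb⟩
    omega

/-! ### Colouring along a chordal supergraph -/

/-- Dirac's lemma, in a form suited to induction: in a chordal graph, if `U` contains a vertex
outside the closed neighbourhood of `a ∈ U`, then it contains such a vertex that is simplicial
in `U`. It is found in a component `C` of the non-neighbours of `a` together with its attachments,
which form a clique. -/
theorem IsChordal.exists_simplicial_not_touch (hG : G.IsChordal) (U : Finset V) :
    ∀ a ∈ U, (∃ x ∈ U, ¬ G.Touch a x) → ∃ v ∈ U, ¬ G.Touch a v ∧
      ∀ p ∈ U, ∀ q ∈ U, G.Adj v p → G.Adj v q → G.Touch p q := by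
  classical
  induction U using Finset.strongInduction with
  | H U ih =>
  rintro a ha ⟨x, hx, hax⟩
  set W : Set V := {y | y ∈ U ∧ ¬ G.Touch a y} with hW
  set C : Set V := {v | G.Linked W x v} with hC
  have hCW : ∀ v ∈ C, v ∈ W := by
    intro v hv
    rcases Linked.eq_or_mem hv with rfl | h
    exacts [⟨hx, hax⟩, h]
  have hxC : x ∈ C := Linked.refl x
  have hCC : ∀ v ∈ C, G.Linked C x v := by
    intro v hv
    induction hv with
    | refl => exact .refl _
    | tail h1 h2 ih => exact ih.trans (.of_adj h2.1 h1 (ReflTransGen.tail h1 h2))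
  -- a neighbour of `C` in `U` is in `C` or adjacent to `a`
  have hnbr : ∀ v ∈ C, ∀ t ∈ U, G.Adj v t → t ∉ C → G.Adj a t := by
    intro v hv t ht hvt htC
    by_contra hat
    refine htC (ReflTransGen.tail hv ⟨hvt, hCW v hv, ht, ?_⟩)
    rintro (rfl | h)
    · exact (hCW v hv).2 (Or.inr hvt.symm)
    · exact hat h
  let U' := U.filter fun t => t ∈ C ∨ ∃ v ∈ C, G.Adj v t
  have hU' : ∀ t, t ∈ U' ↔ t ∈ U ∧ (t ∈ C ∨ ∃ v ∈ C, G.Adj v t) := fun t => Finset.mem_filter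
  have haU' : a ∉ U' := by
    rw [hU']
    rintro ⟨-, h | ⟨v, hv, h⟩⟩
    · exact (hCW a h).2 (Or.inl rfl)
    · exact (hCW v hv).2 (Or.inr h.symm)
  have hssub : U' ⊂ U := (Finset.ssubset_iff_of_subset (Finset.filter_subset _ _)).2 ⟨a, ha, haU'⟩
  have hclique : ∀ s ∈ U', s ∉ C → ∀ t ∈ U', t ∉ C → G.Touch s t := by
    intro s hs hsC t ht htC
    by_contra hst
    rw [hU'] at hs ht
    obtain ⟨v, hv, hvs⟩ := hs.2.resolve_left hsC
    obtain ⟨w, hw, hwt⟩ := ht.2.resolve_left htC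
    have has := hnbr v hv s hs.1 hvs hsC
    have hat := hnbr w hw t ht.1 hwt htC
    have hsub : C ⊆ insert s (insert t C) := fun y hy => Or.inr (Or.inr hy)
    have hl : G.Linked (insert s (insert t C)) s t :=
      ((Linked.of_adj hvs.symm (Or.inl rfl) (hsub hv)).trans
        (((hCC v hv).symm.trans (hCC w hw)).mono hsub)).trans
        (.of_adj hwt (hsub hw) (Or.inr (Or.inl rfl)))
    obtain ⟨S, hS, -⟩ := hl.exists_isHole (v := a) (by
        rintro (h | h | h)
        · exact has.ne h
        · exact hat.ne h
        · exact (hCW a h).2 (Or.inl rfl)) (Or.inr (Or.inl rfl)) has hat hst (by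
        rintro c (h | h | h) hc
        · exact Or.inl h
        · exact Or.inr h
        · exact absurd (Or.inr hc) (hCW c h).2)
    exact hG S hS
  obtain ⟨v, hvC, hv⟩ : ∃ v ∈ C, ∀ p ∈ U', ∀ q ∈ U', G.Adj v p → G.Adj v q → G.Touch p q := by
    by_cases h1 : ∃ t ∈ U', t ∉ C ∧ ∃ y ∈ U', ¬ G.Touch t y
    · obtain ⟨t, ht, htC, hy⟩ := h1
      obtain ⟨v, hvU, htv, hv⟩ := ih U' hssub t ht hy
      refine ⟨v, ?_, hv⟩
      by_contra hvC
      exact htv (hclique t ht htC v hvU hvC)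
    · push Not at h1
      by_cases h2 : ∃ b ∈ U', ∃ y ∈ U', ¬ G.Touch b y
      · obtain ⟨b, hb, hy⟩ := h2
        obtain ⟨v, hvU, hbv, hv⟩ := ih U' hssub b hb hy
        refine ⟨v, ?_, hv⟩
        by_contra hvC
        exact hbv (h1 v hvU hvC b hb).symm
      · push Not at h2
        exact ⟨x, hxC, fun p hp q hq _ _ => h2 p hp q hq⟩
  have hmem : ∀ p ∈ U, G.Adj v p → p ∈ U' := fun p hp h => (hU' p).2 ⟨hp, Or.inr ⟨v, hvC, h⟩⟩
  exact ⟨v, (hCW v hvC).1, (hCW v hvC).2,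
    fun p hp q hq h1 h2 => hv p (hmem p hp h1) q (hmem q hq h2) h1 h2⟩

theorem IsChordal.exists_simplicial (hG : G.IsChordal) {U : Finset V} (hU : U.Nonempty) :
    ∃ v ∈ U, ∀ p ∈ U, ∀ q ∈ U, G.Adj v p → G.Adj v q → G.Touch p q := by
  obtain ⟨a, ha⟩ := hU
  by_cases h : ∃ b ∈ U, ∃ x ∈ U, ¬ G.Touch b x
  · obtain ⟨b, hb, hx⟩ := h
    obtain ⟨v, hv, -, h⟩ := hG.exists_simplicial_not_touch U b hb hx
    exact ⟨v, hv, h⟩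
  · push Not at h
    exact ⟨a, ha, fun p hp q hq _ _ => h p hp q hq⟩

/-- Greedy colouring along a perfect elimination ordering of a chordal supergraph. -/
theorem CorrespondenceAssignment.exists_partial_coloring {H : SimpleGraph V} (hGH : G ≤ H)
    (hH : H.IsChordal) {m : ℕ} (hm : ∀ K : Finset V, H.IsClique K → K.card ≤ m)
    (M : G.CorrespondenceAssignment) (hM : ∀ v, m ≤ (M.list v).card) (U : Finset V) :
    ∃ φ : V → ℕ, (∀ v ∈ U, φ v ∈ M.list v) ∧
      ∀ u ∈ U, ∀ v ∈ U, G.Adj u v → ¬ M.corr u v (φ u) (φ v) := by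
  classical
  induction U using Finset.strongInduction with
  | H U ih =>
  rcases U.eq_empty_or_nonempty with rfl | hne
  · exact ⟨fun _ => 0, by simp, by simp⟩
  obtain ⟨v, hv, hsimp⟩ := hH.exists_simplicial hne
  obtain ⟨φ, hφ, hcol⟩ := ih (U.erase v) (Finset.erase_ssubset hv)
  let N := U.filter (H.Adj v)
  have hN : N.card < m := by
    have hvN : v ∉ N := by simp [N]
    have hcl : H.IsClique (insert v N : Finset V) := by
      rw [Finset.coe_insert, isClique_insert]
      refine ⟨fun p hp q hq hpq => ?_, fun b hb _ => (Finset.mem_filter.1 hb).2⟩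
      have hp := Finset.mem_filter.1 hp
      have hq := Finset.mem_filter.1 hq
      exact (hsimp p hp.1 q hq.1 hp.2 hq.2).resolve_left hpq
    have := hm _ hcl
    rw [Finset.card_insert_of_notMem hvN] at this
    omega
  -- the colours at `v` that are matched to the colour of some neighbour
  let F := N.biUnion fun w => (M.list v).filter fun b => M.corr w v (φ w) b
  have hF : F.card ≤ N.card := by
    have : F.card ≤ N.card * 1 := Finset.card_biUnion_le_card_mul _ _ _ fun w _ => by
      rw [Finset.card_le_one]
      intro b hb b' hb'
      exact M.corr_unique (Finset.mem_filter.1 hb).2 (Finset.mem_filter.1 hb').2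
    omega
  obtain ⟨b, hb, hbF⟩ : ∃ b ∈ M.list v, b ∉ F :=
    Finset.exists_mem_notMem_of_card_lt_card (lt_of_le_of_lt hF (hN.trans_le (hM v)))
  have hbw : ∀ w ∈ U, G.Adj w v → ¬ M.corr w v (φ w) b := fun w hw hadj hc =>
    hbF (Finset.mem_biUnion.2 ⟨w, Finset.mem_filter.2 ⟨hw, hGH hadj.symm⟩,
      Finset.mem_filter.2 ⟨hb, hc⟩⟩)
  refine ⟨Function.update φ v b, fun w hw => ?_, fun w hw z hz hadj => ?_⟩
  · by_cases h : w = v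
    · subst h
      simpa using hb
    · rw [Function.update_of_ne h]
      exact hφ w (Finset.mem_erase.2 ⟨h, hw⟩)
  · by_cases h1 : w = v
    · subst h1
      rw [Function.update_self, Function.update_of_ne hadj.ne']
      exact fun h => hbw z hz hadj.symm (M.corr_symm h)
    · by_cases h2 : z = v
      · subst h2
        rw [Function.update_self, Function.update_of_ne h1]
        exact hbw w hw hadj
      · rw [Function.update_of_ne h1, Function.update_of_ne h2]
        exact hcol w (Finset.mem_erase.2 ⟨h1, hw⟩) z (Finset.mem_erase.2 ⟨h2, hz⟩) hadj

theorem dpChromaticNumber_le_of_chordal [Finite V] {H : SimpleGraph V} (hGH : G ≤ H)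
    (hH : H.IsChordal) {m : ℕ} (hm : ∀ K : Finset V, H.IsClique K → K.card ≤ m) :
    G.dpChromaticNumber ≤ m := by
  have := Fintype.ofFinite V
  refine Nat.sInf_le fun M hM => ?_
  obtain ⟨φ, h1, h2⟩ := M.exists_partial_coloring hGH hH hm hM Finset.univ
  exact ⟨φ, fun v => h1 v (Finset.mem_univ v), fun u v =>
    h2 u (Finset.mem_univ u) v (Finset.mem_univ v)⟩

/-! ### Existence of local chordalization partitions -/

/-- Every graph with a vertex has a hole cover with a local chordalization partition, so that the
non-chordality index is never the junk value `sInf ∅` for a non-chordal graph. Restore the vertices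
one at a time. All holes then pass through the vertex just restored, which therefore has the NC
property for lack of holes avoiding it, and its local chordalization leaves no hole. -/
theorem exists_isLocalChordalizationPartition [Finite V] [Nonempty V] (G : SimpleGraph V) :
    ∃ (k : ℕ) (X : Set V) (P : Fin k → Set V), G.IsLocalChordalizationPartition X P := by
  obtain ⟨n, ⟨e⟩⟩ := Finite.exists_equiv_fin V
  -- `e` orders the vertices; `A H i` restores the `i`-th vertex to the completion `H`
  let A : SimpleGraph V → Fin n → SimpleGraph V := fun H i =>
    H ⊔ G.deleteVerts (⋃ j ∈ Set.Ioi i, {e.symm j})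
  let B : Fin (n + 1) → SimpleGraph V := fun i =>
    Fin.induction (motive := fun _ => SimpleGraph V) (G.deleteVerts Set.univ)
      (fun i H => (A H i).localChordalize (e.symm i)) i
  have hlater : ∀ (i : Fin n) (x : V), x ∉ (⋃ j ∈ Set.Ioi i, {e.symm j} : Set V) ↔ e x ≤ i := by
    intro i x
    simp only [Set.mem_iUnion, Set.mem_singleton_iff, not_exists, Set.mem_Ioi]
    constructor
    · intro h
      by_contra hlt
      exact h (e x) (not_le.1 hlt) (e.symm_apply_apply x).symm
    · rintro h j hj rfl
      rw [e.apply_symm_apply] at h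
      exact absurd hj (not_lt.2 h)
  have hAadj : ∀ H i x y, (A H i).Adj x y ↔ H.Adj x y ∨ (G.Adj x y ∧ e x ≤ i ∧ e y ≤ i) := by
    intro H i x y
    rw [← hlater, ← hlater, ← deleteVerts_adj]
    rfl
  have hAhole : ∀ (i : Fin n) (H : SimpleGraph V), H.IsChordal →
      (∀ x y, G.Adj x y → e x < i → e y < i → H.Adj x y) →
      ∀ S, (A H i).IsHole S → e.symm i ∈ S := by
    intro i H hH hGH S hS
    by_contra hiS
    refine hH S (hS.congr fun x hx y hy => ?_)
    rw [hAadj, or_iff_left_iff_imp]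
    rintro ⟨h, hxi, hyi⟩
    have hne : ∀ z ∈ S, e z ≠ i := by
      rintro z hz rfl
      exact hiS (by rwa [e.symm_apply_apply])
    exact hGH x y h (lt_of_le_of_ne hxi (hne x hx)) (lt_of_le_of_ne hyi (hne y hy))
  have hNC : ∀ (i : Fin n) (H : SimpleGraph V), (∀ S, H.IsHole S → e.symm i ∈ S) →
      H.VertexNC (e.symm i) := fun i H h S T _ hT _ hiT => absurd (h T hT) hiT
  have hinv : ∀ i : Fin (n + 1), (B i).IsChordal ∧
      (∀ x y, (B i).Adj x y → (e x).castSucc < i) ∧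
      (∀ x y, G.Adj x y → (e x).castSucc < i → (e y).castSucc < i → (B i).Adj x y) := by
    intro i
    induction i using Fin.induction with
    | zero =>
      have h0 : ∀ x y, ¬ (B 0).Adj x y := by
        intro x y (h : (G.deleteVerts Set.univ).Adj x y)
        rw [deleteVerts_adj] at h
        exact h.2.1 (Set.mem_univ x)
      refine ⟨fun S hS => ?_, fun x y h => absurd h (h0 x y),
        fun x y _ h => absurd h (Fin.not_lt_zero _)⟩
      obtain ⟨x, hx⟩ := hS.nonempty
      obtain ⟨y, hy⟩ := hS.exists_adj hx
      exact h0 x y hy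
    | succ i ih =>
      obtain ⟨h1, h2, h3⟩ := ih
      have hB : B i.succ = (A (B i.castSucc) i).localChordalize (e.symm i) := rfl
      have hhole := hAhole i _ h1 h3
      have hle : ∀ x y, (A (B i.castSucc) i).Adj x y → (e x).castSucc < i.succ := by
        intro x y h
        rw [hAadj] at h
        rw [Fin.castSucc_lt_succ_iff]
        rcases h with h | h
        · exact (Fin.castSucc_lt_castSucc_iff.1 (h2 x y h)).le
        · exact h.2.1
      refine ⟨fun S hS => ?_, fun x y h => ?_, fun x y h hx hy => ?_⟩
      · rw [hB] at hS
        have hiS := (hNC i _ hhole).notMem_of_isHole_localChordalize hS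
        exact hiS (hhole S (isHole_of_localChordalize hiS hS))
      · rw [hB, localChordalize_adj] at h
        rcases h with h | ⟨-, -, S, hS, hx, -⟩
        · exact hle x y h
        · obtain ⟨z, hz⟩ := hS.exists_adj hx
          exact hle x z hz
      · rw [hB, localChordalize_adj, hAadj]
        exact Or.inl (Or.inr ⟨h, Fin.castSucc_lt_succ_iff.1 hx, Fin.castSucc_lt_succ_iff.1 hy⟩)
  refine ⟨n, Set.univ, fun i => {e.symm i}, ⟨Set.univ_nonempty, fun S hS => ?_⟩,
    fun i => Set.singleton_nonempty _, fun i j hij => ?_, ?_, fun i => A (B i.castSucc) i, B, rfl,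
    fun i => ?_⟩
  · rw [Set.inter_univ]
    exact hS.nonempty
  · simpa using hij
  · refine Set.eq_univ_of_forall fun x => Set.mem_iUnion.2 ⟨e x, ?_⟩
    simp
  · obtain ⟨h1, h2, h3⟩ := hinv i.castSucc
    have hhole := hAhole i _ h1 h3
    refine ⟨rfl, ⟨Set.singleton_nonempty _, fun S hS => ⟨_, hhole S hS, rfl⟩⟩,
      ⟨?_, fun S _ => Set.subsingleton_singleton.anti Set.inter_subset_right⟩,
      ⟨[e.symm i], List.nodup_singleton _, by simp, rfl⟩, (hinv i.succ).1⟩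
    rintro u rfl
    exact hNC i _ hhole

end SimpleGraph

theorem mainTheorem1 {V : Type*} [Finite V] (G : SimpleGraph V) :
    G.dpChromaticNumber ≤ G.cliqueNum + G.nonChordalityIndex ∧
    ∀ n : ℕ, ¬ G.IsChordal → ¬ (SimpleGraph.completeGraph (Fin n)).IsMinor G →
      (G.dpChromaticNumber : ℤ) ≤ (n : ℤ) - 2 + (G.nonChordalityIndex : ℤ) := by
  by_cases hG : G.IsChordal
  · refine ⟨?_, fun n h => absurd hG h⟩
    rw [SimpleGraph.nonChordalityIndex, if_pos hG]
    exact SimpleGraph.dpChromaticNumber_le_of_chordal le_rfl hG fun K hK => hK.card_le_cliqueNum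
  · obtain hV | hV := isEmpty_or_nonempty V
    · refine absurd (fun S hS => ?_) hG
      obtain ⟨x, -⟩ := hS.nonempty
      exact hV.elim x
    have hmem : G.nonChordalityIndex ∈ {k : ℕ | ∃ (X : Set V) (P : Fin k → Set V),
        G.IsLocalChordalizationPartition X P} := by
      rw [SimpleGraph.nonChordalityIndex, if_neg hG]
      exact Nat.sInf_mem (SimpleGraph.exists_isLocalChordalizationPartition G)
    obtain ⟨X, P, hP⟩ := hmem
    obtain ⟨H, hGH, hH, h1, h2⟩ := hP.exists_chordal
    refine ⟨SimpleGraph.dpChromaticNumber_le_of_chordal hGH hH h1, fun n _ hn => ?_⟩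
    have h3 : G.dpChromaticNumber ≤ n + G.nonChordalityIndex - 2 :=
      SimpleGraph.dpChromaticNumber_le_of_chordal hGH hH fun K hK => by
        have := h2 n hn K hK
        omega
    have h4 := h2 n hn ∅ (by simp)
    simp only [Finset.card_empty] at h4
    omega
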